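/- **Corollary 2.3.** Let $V$ be a finite-dimensional complex vector space, let $G\subset GL(V)$ be a finite subgroup, and let $\alpha:G\times G\to\mathbb C^\times$ be a normalized two-cocycle, i.e. $\alpha(g,h)\alpha(gh,k)=\alpha(h,k)\alpha(g,hk)$ and $\alpha(1,g)=\alpha(g,1)=1$ for all $g,h,k\in G$. Let $T(V)\#_\alpha G$ be the crossed product: the vector space $T(V)\otimes\mathbb CG$, with elements $s\otimes g=s\overline g$ and multiplication $(r\overline g)(s\overline h)=\alpha(g,h)\,r\,(g\cdot s)\,\overline{gh}$. For a family $\{a_g\}_{g\in G}$ of skew-symmetric bilinear forms $a_g:V\times V\to\mathbb C$, let $A$ be the quotient of $T(V)\#_\alpha G[t]=\mathbb C[t]\otimes(T(V)\#_\alpha G)$, $t$ an indeterminate, by the two-sided ideal generated by all $$vw-wv-\sum_{g\in G}a_g(v,w)\,t\,\overline g\qquad(v,w\in V).$$ A degree-preserving linear section $S(V)\to T(V)$ of the canonical projection $T(V)\to S(V)$ induces a $\mathbb C[t]$-linear map $S(V)\otimes\mathbb CG[t]\to A$. The algebra $A$ is called a *twisted graded Hecke algebra* if this map is an isomorphism of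 $\mathbb C[t]$-modules (this does not depend on the choice of the section). Let $(\ ,\ )$ be any $G$-invariant nondegenerate Hermitian form on $V$. For $g\in G$ put $V^g=\{v\in V: g\cdot v=v\}$ and $C(g)=\{h\in G: hg=gh\}$; then $V=V^g\oplus (V^g)^\perp$. For $h\in G$ let $h^\perp:(V^g)^\perp\to(V^g)^\perp$ be the composite of $h|_{(V^g)^\perp}:(V^g)^\perp\to V$, the quotient map $V\to V/V^g$, and the canonical isomorphism $V/V^g\cong(V^g)^\perp$ (the inverse of the composite $(V^g)^\perp\hookrightarrow V\to V/V^g$). Let $d$ be the number of conjugacy classes of elements $g\in G$ such that $\operatorname{codim}V^g=2$ and $\det(h^\perp)=\alpha(h,g)\alpha(g,h)^{-1}$ for all $h\in C(g)$. Then the set of families $\{a_g\}_{g\in G}$ of skew-symmetric bilinear forms for which $A$ is a twisted graded Hecke algebra is a vector space (a linear subspace of the space of all families of bilinear forms on $V$ indexed by $G$), and its dimension is $$d+\dim\big(\textstyle\bigwedge^2V\big)^G.$$ -/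

import Mathlib

open scoped TensorProduct Polynomial

noncomputable section

namespace TwistedHecke

/-! ### Two-cocycles and crossed products -/

/-- A normalized two-cocycle `α : G × G → ℂˣ` (trivial action on the coefficients). -/
structure TwoCocycle (G : Type*) [Group G] where
  toFun : G → G → ℂˣ
  cocycle : ∀ g h k : G, toFun g h * toFun (g * h) k = toFun h k * toFun g (h * k)
  one_left : ∀ g : G, toFun 1 g = 1
  one_right : ∀ g : G, toFun g 1 = 1

instance {G : Type*} [Group G] : CoeFun (TwoCocycle G) (fun _ => G → G → ℂˣ) :=
  ⟨TwoCocycle.toFun⟩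

section CrossedProduct

variable {G : Type*} [Group G] {S : Type*} [Ring S] [Algebra ℂ S]

/-- The crossed product `S #_α G` of a `ℂ`-algebra `S` on which `G` acts by algebra automorphisms
`ρ`. The underlying vector space is `S ⊗ ℂG`, realised as the finitely supported functions
`G →₀ S`; the element `s ⊗ g` is `CrossedProduct.of ρ α g s`. -/
@[nolint unusedArguments]
def CrossedProduct (_ρ : G →* (S ≃ₐ[ℂ] S)) (_α : TwoCocycle G) : Type _ := G →₀ S

namespace CrossedProduct

variable (ρ : G →* (S ≃ₐ[ℂ] S)) (α : TwoCocycle G)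

instance instAddCommGroup : AddCommGroup (CrossedProduct ρ α) := inferInstanceAs (AddCommGroup (G →₀ S))

instance : Module ℂ (CrossedProduct ρ α) := inferInstanceAs (Module ℂ (G →₀ S))

/-- The identification of the underlying vector space of `S #_α G` with `G →₀ S`. -/
def ofFinsupp : (G →₀ S) ≃ₗ[ℂ] CrossedProduct ρ α := LinearEquiv.refl ℂ (G →₀ S)

/-- `s ↦ s ⊗ g`. -/
def of (g : G) : S →ₗ[ℂ] CrossedProduct ρ α :=
  (ofFinsupp ρ α).toLinearMap ∘ₗ Finsupp.lsingle g

/-- The multiplication on `S ⊗ ℂG`, the biadditive extension of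
`(r ⊗ g) (s ⊗ h) = α(g,h) r (g • s) ⊗ gh`. -/
def mulAux (x y : G →₀ S) : G →₀ S :=
  x.sum fun g r => y.sum fun h s => Finsupp.single (g * h) ((α g h : ℂ) • (r * ρ g s))

variable {ρ α} in
theorem mulAux_add_left (x y z : G →₀ S) :
    mulAux ρ α (x + y) z = mulAux ρ α x z + mulAux ρ α y z := by
  unfold mulAux
  refine Finsupp.sum_add_index' (fun g => ?_) fun g r r' => ?_
  · simp
  · simp [add_mul, Finsupp.single_add, Finsupp.sum_add]

variable {ρ α} in
theorem mulAux_add_right (x y z : G →₀ S) :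
    mulAux ρ α x (y + z) = mulAux ρ α x y + mulAux ρ α x z := by
  unfold mulAux
  rw [← Finsupp.sum_add]
  refine Finsupp.sum_congr fun g _ => ?_
  refine Finsupp.sum_add_index' (fun h => ?_) fun h r r' => ?_
  · simp
  · simp [mul_add, Finsupp.single_add]

variable {ρ α} in
theorem mulAux_single (g h : G) (r s : S) :
    mulAux ρ α (Finsupp.single g r) (Finsupp.single h s) =
      Finsupp.single (g * h) ((α g h : ℂ) • (r * ρ g s)) := by
  unfold mulAux
  rw [Finsupp.sum_single_index (by simp), Finsupp.sum_single_index (by simp)]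

instance : Mul (CrossedProduct ρ α) := ⟨mulAux ρ α⟩

instance : One (CrossedProduct ρ α) := ⟨of ρ α 1 1⟩

variable {ρ α}

theorem one_eq : (1 : CrossedProduct ρ α) = of ρ α 1 1 := rfl

theorem induction {p : CrossedProduct ρ α → Prop} (x : CrossedProduct ρ α)
    (zero : p 0) (add : ∀ x y, p x → p y → p (x + y)) (single : ∀ g s, p (of ρ α g s)) : p x :=
  Finsupp.induction_linear (motive := p) x zero add single

theorem add_mul_aux (x y z : CrossedProduct ρ α) : (x + y) * z = x * z + y * z :=
  mulAux_add_left x y z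

theorem mul_add_aux (x y z : CrossedProduct ρ α) : x * (y + z) = x * y + x * z :=
  mulAux_add_right x y z

theorem zero_mul_aux (x : CrossedProduct ρ α) : 0 * x = 0 := by
  simpa using add_mul_aux 0 0 x

theorem mul_zero_aux (x : CrossedProduct ρ α) : x * 0 = 0 := by
  simpa using mul_add_aux x 0 0

theorem of_mul_of (g h : G) (r s : S) :
    of ρ α g r * of ρ α h s = of ρ α (g * h) ((α g h : ℂ) • (r * ρ g s)) :=
  mulAux_single g h r s

instance : Ring (CrossedProduct ρ α) :=
  { instAddCommGroup ρ α with
    mul := (· * ·)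
    one := 1
    left_distrib := mul_add_aux
    right_distrib := add_mul_aux
    zero_mul := zero_mul_aux
    mul_zero := mul_zero_aux
    one_mul := fun x => by
      refine induction (p := fun x => 1 * x = x) x (mul_zero_aux _) (fun x y hx hy => ?_) fun g s => ?_
      · rw [mul_add_aux, hx, hy]
      · simp [one_eq, of_mul_of, α.one_left]
    mul_one := fun x => by
      refine induction (p := fun x => x * 1 = x) x (zero_mul_aux _) (fun x y hx hy => ?_) fun g s => ?_
      · rw [add_mul_aux, hx, hy]
      · simp [one_eq, of_mul_of, α.one_right]
    mul_assoc := fun x y z => by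
      refine induction (p := fun x => x * y * z = x * (y * z)) x (by simp only [zero_mul_aux])
        (fun x x' hx hx' => by simp only [add_mul_aux, hx, hx']) fun g r => ?_
      refine induction (p := fun y => of ρ α g r * y * z = of ρ α g r * (y * z)) y
        (by simp only [zero_mul_aux, mul_zero_aux])
        (fun x x' hx hx' => by simp only [add_mul_aux, mul_add_aux, hx, hx']) fun h s => ?_
      refine induction (p := fun z => of ρ α g r * of ρ α h s * z = of ρ α g r * (of ρ α h s * z)) z
        (by simp only [mul_zero_aux])
        (fun x x' hx hx' => by simp only [mul_add_aux, hx, hx']) fun k t => ?_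
      have hc : (α (g * h) k : ℂ) * (α g h : ℂ) = (α g (h * k) : ℂ) * (α h k : ℂ) := by
        rw [mul_comm, mul_comm (α g (h * k) : ℂ)]
        exact_mod_cast α.cocycle g h k
      simp only [of_mul_of]
      simp only [map_smul, map_mul, smul_mul_assoc, mul_smul_comm, smul_smul, hc, mul_assoc,
        AlgEquiv.mul_apply] }

theorem smul_of (c : ℂ) (g : G) (s : S) : c • of ρ α g s = of ρ α g (c • s) :=
  ((of ρ α g).map_smul c s).symm

instance : Algebra ℂ (CrossedProduct ρ α) :=
  Algebra.ofModule
    (fun c x y => by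
      refine induction (p := fun x => c • x * y = c • (x * y)) x
        (by simp only [smul_zero, zero_mul_aux])
        (fun x x' hx hx' => by simp only [add_mul_aux, smul_add, hx, hx']) fun g r => ?_
      refine induction (p := fun y => c • of ρ α g r * y = c • (of ρ α g r * y)) y
        (by simp only [smul_zero, mul_zero_aux])
        (fun x x' hx hx' => by simp only [mul_add_aux, smul_add, hx, hx']) fun h s => ?_
      simp only [smul_of, of_mul_of]
      simp only [smul_mul_assoc, smul_comm c])
    (fun c x y => by
      refine induction (p := fun x => x * c • y = c • (x * y)) x
        (by simp only [smul_zero, zero_mul_aux])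
        (fun x x' hx hx' => by simp only [add_mul_aux, smul_add, hx, hx']) fun g r => ?_
      refine induction (p := fun y => of ρ α g r * c • y = c • (of ρ α g r * y)) y
        (by simp only [smul_zero, mul_zero_aux])
        (fun x x' hx hx' => by simp only [mul_add_aux, smul_add, hx, hx']) fun h s => ?_
      simp only [smul_of, of_mul_of]
      simp only [map_smul (ρ g), mul_smul_comm, smul_comm c])

end CrossedProduct

end CrossedProduct

/-! ### The algebra attached to a family of bilinear forms -/

section Hecke

variable {V : Type*} [AddCommGroup V] [Module ℂ V]

/-- The action of `GL(V)` on the tensor algebra `T(V)` by algebra automorphisms, extending its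
action on `V`. -/
def tensorAction : (V ≃ₗ[ℂ] V) →* (TensorAlgebra ℂ V ≃ₐ[ℂ] TensorAlgebra ℂ V) where
  toFun g := AlgEquiv.ofAlgHom
    (TensorAlgebra.lift ℂ (TensorAlgebra.ι ℂ ∘ₗ g.toLinearMap))
    (TensorAlgebra.lift ℂ (TensorAlgebra.ι ℂ ∘ₗ g.symm.toLinearMap))
    (by ext; simp) (by ext; simp)
  map_one' := by
    refine AlgEquiv.coe_toAlgHom_injective ?_
    ext; simp
  map_mul' g h := by
    refine AlgEquiv.coe_toAlgHom_injective ?_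
    ext; simp

theorem tensorAction_ι (g : V ≃ₗ[ℂ] V) (v : V) :
    tensorAction g (TensorAlgebra.ι ℂ v) = TensorAlgebra.ι ℂ (g v) := by
  simp [tensorAction]

variable {G : Subgroup (V ≃ₗ[ℂ] V)} (α : TwoCocycle G)

/-- The crossed product `T(V) #_α G`. -/
abbrev TensorCrossed : Type _ := CrossedProduct (tensorAction.comp G.subtype) α

/-- `T(V) #_α G [t] = ℂ[t] ⊗ (T(V) #_α G)`. -/
abbrev TensorCrossedPoly : Type _ := ℂ[X] ⊗[ℂ] TensorCrossed α

/-- The vector `v ∈ V`, as the element `v ⊗ 1` of `T(V) #_α G [t]`. -/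
def vec (v : V) : TensorCrossedPoly α :=
  1 ⊗ₜ CrossedProduct.of (tensorAction.comp G.subtype) α 1 (TensorAlgebra.ι ℂ v)

/-- The element `t ḡ` of `T(V) #_α G [t]`. -/
def tBar (g : G) : TensorCrossedPoly α :=
  Polynomial.X ⊗ₜ CrossedProduct.of (tensorAction.comp G.subtype) α g 1

variable [Finite G]

/-- The two-sided ideal `I[t]` generated by all `[v, w] - ∑_g a_g(v, w) t ḡ`. -/
def heckeIdeal (a : G → LinearMap.BilinForm ℂ V) : TwoSidedIdeal (TensorCrossedPoly α) :=
  TwoSidedIdeal.span {x | ∃ v w : V,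
    x = (vec α v * vec α w - vec α w * vec α v) - ∑ᶠ g : G, a g v w • tBar α g}

/-- The quotient algebra `A = T(V) #_α G [t] / I[t]`. -/
def HeckeAlgebra (a : G → LinearMap.BilinForm ℂ V) : Type _ :=
  (heckeIdeal α a).ringCon.Quotient

instance (a : G → LinearMap.BilinForm ℂ V) : Ring (HeckeAlgebra α a) :=
  inferInstanceAs (Ring (heckeIdeal α a).ringCon.Quotient)

instance (a : G → LinearMap.BilinForm ℂ V) : Algebra ℂ[X] (HeckeAlgebra α a) :=
  inferInstanceAs (Algebra ℂ[X] (heckeIdeal α a).ringCon.Quotient)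

/-- The quotient map `T(V) #_α G [t] → A`. -/
def HeckeAlgebra.mk (a : G → LinearMap.BilinForm ℂ V) :
    TensorCrossedPoly α →ₐ[ℂ[X]] HeckeAlgebra α a :=
  RingCon.mkₐ ℂ[X] (heckeIdeal α a).ringCon

/-- A linear section `S(V) → T(V)` of the canonical projection `T(V) → S(V)` which respects
degrees: it maps the degree `m` part of `S(V)` (the image of `T^m(V) = V ⊗ ⋯ ⊗ V`) to `T^m(V)`. -/
structure IsGradedSection (σ : SymmetricAlgebra ℂ V →ₗ[ℂ] TensorAlgebra ℂ V) : Prop where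
  section' : ∀ s, SymmetricAlgebra.algHom ℂ V (σ s) = s
  graded : ∀ (m : ℕ), ∀ x ∈ LinearMap.range (TensorAlgebra.ι ℂ (M := V)) ^ m,
    σ (SymmetricAlgebra.algHom ℂ V x) ∈ LinearMap.range (TensorAlgebra.ι ℂ (M := V)) ^ m

/-- The `ℂ[t]`-linear map `ℂ[t] ⊗ (S(V) ⊗ ℂG) → A` induced by a linear map `S(V) → T(V)`; the
underlying vector space `S(V) ⊗ ℂG` of `S(V) #_α G` is realised as `G →₀ S(V)`. -/
def additiveMap (a : G → LinearMap.BilinForm ℂ V)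
    (σ : SymmetricAlgebra ℂ V →ₗ[ℂ] TensorAlgebra ℂ V) :
    ℂ[X] ⊗[ℂ] (G →₀ SymmetricAlgebra ℂ V) →ₗ[ℂ[X]] HeckeAlgebra α a :=
  (HeckeAlgebra.mk α a).toLinearMap ∘ₗ
    LinearMap.baseChange ℂ[X]
      ((CrossedProduct.ofFinsupp (tensorAction.comp G.subtype) α).toLinearMap ∘ₗ
        Finsupp.mapRange.linearMap σ)

/-- `A` is a twisted graded Hecke algebra: the `a_g` are skew-symmetric bilinear forms, and
`S(V) ⊗ ℂG[t] → A` is an isomorphism of `ℂ[t]`-modules. (Two degree-preserving sections differ by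
terms which the relations of `A` rewrite in lower degree, so the choice of `σ` is immaterial.) -/
def IsTwistedGradedHecke (a : G → LinearMap.BilinForm ℂ V) : Prop :=
  (∀ g v w, a g v w = -a g w v) ∧
    ∃ σ : SymmetricAlgebra ℂ V →ₗ[ℂ] TensorAlgebra ℂ V,
      IsGradedSection σ ∧ Function.Bijective (additiveMap α a σ)

end Hecke

/-! ### The determinants of `h^⊥` -/

section Perp

variable {V : Type*} [AddCommGroup V] [Module ℂ V]

/-- The fixed space `V^g`. -/
def fixedSpace (g : V ≃ₗ[ℂ] V) : Submodule ℂ V := LinearMap.eqLocus g.toLinearMap LinearMap.id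

theorem mem_fixedSpace {g : V ≃ₗ[ℂ] V} {v : V} : v ∈ fixedSpace g ↔ g v = v := Iff.rfl

/-- A `G`-invariant nondegenerate Hermitian form on `V` (conjugate-linear in the first variable). -/
structure InvariantHermitianForm (G : Subgroup (V ≃ₗ[ℂ] V)) where
  form : V →ₗ⋆[ℂ] V →ₗ[ℂ] ℂ
  hermitian : ∀ v w, star (form v w) = form w v
  nondegenerate : ∀ v, (∀ w, form v w = 0) → v = 0
  invariant : ∀ g ∈ G, ∀ v w, form (g v) (g w) = form v w

variable {G : Subgroup (V ≃ₗ[ℂ] V)} (B : InvariantHermitianForm G)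

/-- The orthogonal complement `(V^g)^⊥`. -/
def fixedPerp (g : V ≃ₗ[ℂ] V) : Submodule ℂ V := (fixedSpace g).orthogonalBilin B.form

theorem mem_fixedPerp {g : V ≃ₗ[ℂ] V} {v : V} :
    v ∈ fixedPerp B g ↔ ∀ u, g u = u → B.form u v = 0 := Iff.rfl

/-- For `g` of finite order, the decomposition `V = V^g ⊕ (V^g)^⊥`. -/
theorem isCompl_fixedPerp [Finite G] (g : G) :
    IsCompl (fixedSpace (g : V ≃ₗ[ℂ] V)) (fixedPerp B g) := by
  set γ : V ≃ₗ[ℂ] V := (g : V ≃ₗ[ℂ] V) with hγ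
  have hr : 0 < orderOf g := orderOf_pos g
  have hr' : ((orderOf g : ℕ) : ℂ) ≠ 0 := by exact_mod_cast hr.ne'
  have hpow : γ ^ orderOf g = 1 := by
    have := congrArg Subtype.val (pow_orderOf_eq_one g)
    exact this
  set s : V → V := fun v => ∑ k ∈ Finset.range (orderOf g), (γ ^ k) v with hs
  have hsfix : ∀ v, γ (s v) = s v := by
    intro v
    have h1 : γ (s v) = ∑ k ∈ Finset.range (orderOf g), (γ ^ (k + 1)) v := by
      simp [hs, map_sum, pow_succ']
    have h2 := Finset.sum_range_succ' (fun k => (γ ^ k) v) (orderOf g)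
    have h3 := Finset.sum_range_succ (fun k => (γ ^ k) v) (orderOf g)
    rw [h1]
    rw [h3, hpow, pow_zero] at h2
    exact (add_right_cancel h2).symm
  have hB : ∀ u, γ u = u → ∀ v, B.form u (s v) = orderOf g * B.form u v := by
    intro u hu v
    have hk : ∀ k : ℕ, B.form u ((γ ^ k) v) = B.form u v := by
      intro k
      induction k with
      | zero => simp
      | succ k ih =>
        rw [pow_succ', LinearEquiv.mul_apply]
        conv_lhs => rw [← hu]
        rw [B.invariant γ g.2, ih]
    simp [hs, map_sum, hk]
  rw [isCompl_iff, disjoint_iff_inf_le, codisjoint_iff_le_sup]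
  refine ⟨fun u hu => ?_, fun v _ => ?_⟩
  · obtain ⟨hu1, hu2⟩ := hu
    refine B.nondegenerate u fun w => ?_
    have h1 := hB u hu1 w
    have h2 : B.form u (s w) = 0 := by
      rw [← B.hermitian, hu2 (s w) (hsfix w), star_zero]
    rw [h2] at h1
    exact (mul_eq_zero.mp h1.symm).resolve_left hr'
  · have hv : v = (orderOf g : ℂ)⁻¹ • s v + (v - (orderOf g : ℂ)⁻¹ • s v) := by abel
    rw [hv]
    refine Submodule.add_mem_sup (Submodule.smul_mem _ _ (hsfix v)) fun u hu => ?_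
    rw [map_sub, map_smul, hB u hu, smul_eq_mul, inv_mul_cancel_left₀ hr', sub_self]

/-- The map `h^⊥`: the composite `(V^g)^⊥ → V → V/V^g ≅ (V^g)^⊥` of the restriction of `h`, the
quotient map, and the canonical isomorphism (the inverse of `(V^g)^⊥ ⊆ V → V/V^g`). -/
def hPerp [Finite G] (g h : G) : fixedPerp B g →ₗ[ℂ] fixedPerp B g :=
  (Submodule.quotientEquivOfIsCompl _ _ (isCompl_fixedPerp B g)).toLinearMap ∘ₗ
    (fixedSpace (g : V ≃ₗ[ℂ] V)).mkQ ∘ₗ (h : V ≃ₗ[ℂ] V).toLinearMap ∘ₗ (fixedPerp B g).subtype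

/-- The condition on `g`: `codim V^g = 2` and `det(h^⊥) = α(h,g) α(g,h)⁻¹` for all `h ∈ C(g)`. -/
def IsAdmissible [Finite G] (α : TwoCocycle G) (g : G) : Prop :=
  Module.finrank ℂ (V ⧸ fixedSpace (g : V ≃ₗ[ℂ] V)) = 2 ∧
    ∀ h : G, h * g = g * h → LinearMap.det (hPerp B g h) = ((α h g * (α g h)⁻¹ : ℂˣ) : ℂ)

/-- The number `d` of conjugacy classes of elements satisfying the condition above. -/
def numAdmissible [Finite G] (α : TwoCocycle G) : ℕ :=
  Nat.card {C : ConjClasses G // ∃ g : G, ConjClasses.mk g = C ∧ IsAdmissible B α g}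

/-- The invariants `(⋀² V)^G`. -/
def exteriorInvariants (G : Subgroup (V ≃ₗ[ℂ] V)) : Submodule ℂ (⋀[ℂ]^2 V) where
  carrier := {x | ∀ g ∈ G, exteriorPower.map 2 g.toLinearMap x = x}
  zero_mem' := by simp
  add_mem' hx hy g hg := by rw [map_add, hx g hg, hy g hg]
  smul_mem' c x hx g hg := by rw [map_smul, hx g hg]

/-- Every finite group of linear automorphisms leaves some nondegenerate Hermitian form
invariant. -/
theorem nonempty_invariantHermitianForm [FiniteDimensional ℂ V] [Finite G] :
    Nonempty (InvariantHermitianForm G) := by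
  classical
  have := Fintype.ofFinite G
  let b := Module.finBasis ℂ V
  let e : V ≃ₗ[ℂ] EuclideanSpace ℂ (Fin (Module.finrank ℂ V)) :=
    b.equivFun ≪≫ₗ (WithLp.linearEquiv 2 ℂ _).symm
  let F : V →ₗ⋆[ℂ] V →ₗ[ℂ] ℂ := LinearMap.mk₂'ₛₗ (starRingEnd ℂ) (RingHom.id ℂ)
    (fun v w => ∑ g : G, inner ℂ (e (g.1 v)) (e (g.1 w)))
    (by intros; simp [Finset.sum_add_distrib])
    (by intros; simp [Finset.mul_sum, mul_comm])
    (by intros; simp [Finset.sum_add_distrib])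
    (by intros; simp [Finset.mul_sum])
  refine ⟨F, fun v w => ?_, fun v hv => ?_, fun g hg v w => ?_⟩
  · simp only [F, LinearMap.mk₂'ₛₗ_apply, star_sum]
    exact Finset.sum_congr rfl fun g _ => inner_conj_symm _ _
  · have h0 := congrArg Complex.re (hv v)
    simp only [F, LinearMap.mk₂'ₛₗ_apply, Complex.re_sum, Complex.zero_re] at h0
    have h1 := (Finset.sum_eq_zero_iff_of_nonneg
      (fun (g : G) _ => inner_self_nonneg (𝕜 := ℂ) (x := e (g.1 v)))).mp h0 1 (Finset.mem_univ _)
    have h2 : e v = 0 := by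
      rw [← inner_self_eq_zero (𝕜 := ℂ)]
      exact Complex.ext (by simpa using h1) (inner_self_im (𝕜 := ℂ) (e v))
    simpa using h2
  · simp only [F, LinearMap.mk₂'ₛₗ_apply]
    exact Fintype.sum_equiv (Equiv.mulRight (⟨g, hg⟩ : G)) _ _ fun x => by simp

end Perp

end TwistedHecke

end

/-! The problem splits into a PBW theorem and linear algebra. By the PBW theorem, `A` is a twisted
graded Hecke algebra exactly when the skew forms satisfy the conditions of `IsCompatible`:
a_{hgh⁻¹}(hv, hw) is a_g(v, w) times the scalar produced by conjugating ḡ with h̄, and for every g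
the cyclic sum of a_g(u, v)(gw − w) vanishes.

Necessity: in `A` compare coefficients of t in h̄[v, w] = [hv, hw]h̄ and in the Jacobi identity for
commutators of u, v, w. Sufficiency: sorted words span because swapping a descent costs only terms
two degrees lower (`additiveMap_surjective`). They are independent because T(V) carries a normal
form N with values in S(V) ⊗ ℂG[t] that respects the relations (`exists_normalForm`). It is built
degree by degree by a diamond-lemma argument (`Straightens.unique`): disjoint swaps are confluent by
equivariance, overlapping ones by the Jacobi condition. Extended to the crossed product, N kills the
ideal and inverts the additive map.

Linear algebra: the image of g − 1 has dimension codim V^g. The Jacobi condition gives a_g = 0 if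
this exceeds 2, and together with a_g(gv, gw) = a_g(v, w) it also excludes codimension 1. In
codimension 2, V^g lies in the radical of a_g, so a_g is a multiple of the volume form of (V^g)^⊥.
On that form h ∈ C(g) acts by det(h^⊥), so a_g ≠ 0 forces g to be admissible. Conversely, averaging
the volume form over conjugates yields a nonzero family on each admissible class. Hence a family
amounts to an invariant skew form a_1 and one free scalar per admissible class. Invariant skew forms
have the dimension of (⋀²V)^G, since the averaging projection and its transpose have equal rank. -/

noncomputable section

namespace TwistedHecke

/-! ### Straightening words -/

section Straightening

variable {d : ℕ} {M : Type*} [AddCommGroup M]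

/-- A weight on words which decreases when a descent is swapped. -/
def wordWeight : List (Fin d) → ℕ
  | [] => 0
  | i :: w => i * w.length + wordWeight w

/-- Letters are weighted by the number of letters to their right, so the swap moves the larger
letter to the smaller factor and lowers the weight by i − j. The prefix sees only lengths. -/
theorem wordWeight_swap_lt {i j : Fin d} (hij : j < i) (p q : List (Fin d)) :
    wordWeight (p ++ j :: i :: q) < wordWeight (p ++ i :: j :: q) := by
  induction p with
  | nil =>
    have : (j : ℕ) < i := hij
    simp only [List.nil_append, wordWeight, List.length_cons]
    nlinarith
  | cons k p ih => simpa [wordWeight] using ih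

theorem sorted_or_exists_descent (w : List (Fin d)) :
    w.Pairwise (· ≤ ·) ∨ ∃ p i j q, j < i ∧ w = p ++ i :: j :: q := by
  induction w with
  | nil => exact Or.inl List.Pairwise.nil
  | cons k w ih =>
    rcases ih with h | ⟨p, i, j, q, hij, rfl⟩
    · cases w with
      | nil => exact Or.inl (List.pairwise_singleton _ _)
      | cons l w =>
        rcases lt_or_ge l k with hlk | hkl
        · exact Or.inr ⟨[], k, l, w, hlk, rfl⟩
        · refine Or.inl (List.pairwise_cons.mpr ⟨fun x hx => ?_, h⟩)
          rcases List.mem_cons.mp hx with rfl | hx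
          · exact hkl
          · exact hkl.trans ((List.pairwise_cons.mp h).1 x hx)
    · exact Or.inr ⟨k :: p, i, j, q, hij, rfl⟩

theorem not_sorted_of_descent {i j : Fin d} (hij : j < i) (p q : List (Fin d)) :
    ¬ (p ++ i :: j :: q).Pairwise (· ≤ ·) := fun h =>
  hij.not_ge ((List.pairwise_cons.mp (List.pairwise_append.mp h).2.1).1 j (by simp))

/-- `Straightens φ f w y`: the value `y` is obtained from the word `w` by swapping descents,
each of which contributes a term `φ`, until a sorted word is reached, which is evaluated by `f`. -/
inductive Straightens (φ : List (Fin d) → Fin d → Fin d → List (Fin d) → M)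
    (f : List (Fin d) → M) : List (Fin d) → M → Prop
  | sorted (w : List (Fin d)) (h : w.Pairwise (· ≤ ·)) : Straightens φ f w (f w)
  | swap (p : List (Fin d)) (i j : Fin d) (q : List (Fin d)) (y : M) (h : j < i)
      (hy : Straightens φ f (p ++ j :: i :: q) y) :
      Straightens φ f (p ++ i :: j :: q) (y + φ p i j q)

variable {φ : List (Fin d) → Fin d → Fin d → List (Fin d) → M} {f : List (Fin d) → M}

theorem Straightens.exists (w : List (Fin d)) : ∃ y, Straightens φ f w y := by
  induction hm : wordWeight w using Nat.strong_induction_on generalizing w with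
  | _ m ih =>
    subst hm
    rcases sorted_or_exists_descent w with h | ⟨p, i, j, q, hij, rfl⟩
    · exact ⟨_, .sorted w h⟩
    · obtain ⟨y, hy⟩ := ih _ (wordWeight_swap_lt hij p q) _ rfl
      exact ⟨_, .swap p i j q y hij hy⟩

theorem Straightens.inv {w : List (Fin d)} {y : M} (h : Straightens φ f w y) :
    (w.Pairwise (· ≤ ·) ∧ y = f w) ∨ ∃ p i j q z, j < i ∧ w = p ++ i :: j :: q ∧
      Straightens φ f (p ++ j :: i :: q) z ∧ y = z + φ p i j q := by
  cases h with
  | sorted w h => exact Or.inl ⟨h, rfl⟩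
  | swap p i j q z h hz => exact Or.inr ⟨p, i, j, q, z, h, rfl, hz, rfl⟩

/-- The compatibility of swaps in disjoint positions, for words of length `n`. -/
def SwapsCommute (φ : List (Fin d) → Fin d → Fin d → List (Fin d) → M) (n : ℕ) : Prop :=
  ∀ p i j q k l r, (p ++ i :: j :: (q ++ k :: l :: r)).length = n →
    φ (p ++ j :: i :: q) k l r + φ p i j (q ++ k :: l :: r) =
      φ p i j (q ++ l :: k :: r) + φ (p ++ i :: j :: q) k l r

/-- The compatibility of swaps in overlapping positions, for words of length `n`. -/
def SwapsBraid (φ : List (Fin d) → Fin d → Fin d → List (Fin d) → M) (n : ℕ) : Prop :=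
  ∀ p i j k q, (p ++ i :: j :: k :: q).length = n →
    φ p j k (i :: q) + φ (p ++ [j]) i k q + φ p i j (k :: q) =
      φ (p ++ [k]) i j q + φ p i k (j :: q) + φ (p ++ [i]) j k q

/-- Newman's lemma for sorting: by induction on the weight, values are unique after one swap, so it
suffices to join any two first swaps. They coincide, overlap in one letter (`SwapsBraid`) or are
disjoint (`SwapsCommute`). -/
theorem Straightens.unique {n : ℕ} (hc : SwapsCommute φ n) (hb : SwapsBraid φ n)
    {w : List (Fin d)} (hw : w.length = n) {y z : M}
    (hy : Straightens φ f w y) (hz : Straightens φ f w z) : y = z := by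
  induction hm : wordWeight w using Nat.strong_induction_on generalizing w y z with
  | _ m ih =>
    subst hm
    -- By symmetry the second descent starts `a.length` places to the right of the first; lengths 0,
    -- 1 and at least 2 are the three cases.
    have key : ∀ p i j q a i' j' q' y z, j < i → j' < i' →
        w = p ++ i :: j :: q → i :: j :: q = a ++ i' :: j' :: q' →
        Straightens φ f (p ++ j :: i :: q) y →
        Straightens φ f ((p ++ a) ++ j' :: i' :: q') z →
        y + φ p i j q = z + φ (p ++ a) i' j' q' := by
      intro p i j q a i' j' q' y z hij hij' hwe ha hy₁ hz₁
      rcases a with _ | ⟨b, _ | ⟨c, a⟩⟩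
      · obtain ⟨rfl, rfl, rfl⟩ : i = i' ∧ j = j' ∧ q = q' := by simpa using ha
        rw [List.append_nil] at hz₁ ⊢
        subst hwe
        rw [ih _ (wordWeight_swap_lt hij p q) (by simpa using hw) hy₁ hz₁ rfl]
      · obtain ⟨rfl, rfl, rfl⟩ : i = b ∧ j = i' ∧ q = j' :: q' := by simpa using ha
        subst hwe
        -- Both reductions of the strictly decreasing triple meet at its reversal.
        obtain ⟨x, hx⟩ := Straightens.exists (φ := φ) (f := f) (p ++ j' :: j :: i :: q')
        have h1 : Straightens φ f (p ++ j :: i :: j' :: q')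
            (x + φ p j j' (i :: q') + φ (p ++ [j]) i j' q') := by
          have := Straightens.swap (φ := φ) (f := f) (p ++ [j]) i j' q' _ (hij'.trans hij)
            (by simpa using Straightens.swap p j j' (i :: q') x hij' hx)
          simpa using this
        have h2 : Straightens φ f ((p ++ [i]) ++ j' :: j :: q')
            (x + φ (p ++ [j']) i j q' + φ p i j' (j :: q')) := by
          have := Straightens.swap (φ := φ) (f := f) p i j' (j :: q') _ (hij'.trans hij)
            (by simpa using Straightens.swap (p ++ [j']) i j q' x hij (by simpa using hx))
          simpa using this
        rw [ih _ (wordWeight_swap_lt hij p _) (by simpa using hw) hy₁ h1 rfl]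
        rw [ih _ (by simpa using wordWeight_swap_lt hij' (p ++ [i]) q') (by simpa using hw) hz₁ h2
          rfl]
        have := hb p i j j' q' (by simpa using hw)
        simp only [add_assoc] at this ⊢
        rw [this]
      · obtain ⟨rfl, rfl, rfl⟩ : i = b ∧ j = c ∧ q = a ++ i' :: j' :: q' := by simpa using ha
        subst hwe
        obtain ⟨x, hx⟩ := Straightens.exists (φ := φ) (f := f) (p ++ j :: i :: a ++ j' :: i' :: q')
        have h1 : Straightens φ f (p ++ j :: i :: (a ++ i' :: j' :: q'))
            (x + φ (p ++ j :: i :: a) i' j' q') := by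
          simpa using Straightens.swap (φ := φ) (f := f) (p ++ j :: i :: a) i' j' q' x hij' hx
        have h2 : Straightens φ f ((p ++ i :: j :: a) ++ j' :: i' :: q')
            (x + φ p i j (a ++ j' :: i' :: q')) := by
          simpa using Straightens.swap (φ := φ) (f := f) p i j (a ++ j' :: i' :: q') x hij
            (by simpa using hx)
        rw [ih _ (wordWeight_swap_lt hij p _) (by simpa using hw) hy₁ h1 rfl]
        rw [ih _ (by simpa using wordWeight_swap_lt hij' (p ++ i :: j :: a) q')
          (by simpa using hw) hz₁ h2 rfl]
        have := hc p i j a i' j' q' (by simpa using hw)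
        simp only [add_assoc] at this ⊢
        rw [this]
    rcases hy.inv with ⟨hs, rfl⟩ | ⟨p, i, j, q, y₁, hij, hwe, hy₁, rfl⟩
    · rcases hz.inv with ⟨-, rfl⟩ | ⟨p, i, j, q, z, hij, rfl, hz, rfl⟩
      · rfl
      · exact absurd hs (not_sorted_of_descent hij p q)
    · rcases hz.inv with ⟨hs, rfl⟩ | ⟨p', i', j', q', z₁, hij', hwe', hz₁, rfl⟩
      · subst hwe
        exact absurd hs (not_sorted_of_descent hij p q)
      · rcases List.append_eq_append_iff.mp (hwe.symm.trans hwe') with ⟨a, rfl, ha⟩ | ⟨a, rfl, ha⟩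
        · exact key p i j q a i' j' q' y₁ z₁ hij hij' hwe ha hy₁ hz₁
        · exact (key p' i' j' q' a i j q z₁ y₁ hij' hij hwe' ha hz₁ hy₁).symm

/-- Uniqueness makes the straightened value a function of the word. Antisymmetry of `φ` extends the
swap rule from descents to all adjacent pairs. -/
theorem exists_straightening (n : ℕ) (f : List (Fin d) → M) (hc : SwapsCommute φ n)
    (hb : SwapsBraid φ n) (ha : ∀ p i j q, φ p i j q = -φ p j i q) (h0 : ∀ p i q, φ p i i q = 0) :
    ∃ N : List (Fin d) → M, (∀ w, w.Pairwise (· ≤ ·) → w.length = n → N w = f w) ∧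
      ∀ p i j q, (p ++ i :: j :: q).length = n →
        N (p ++ i :: j :: q) = N (p ++ j :: i :: q) + φ p i j q := by
  choose N hN using fun w => Straightens.exists (φ := φ) (f := f) w
  have key : ∀ p i j q, (p ++ i :: j :: q).length = n → j < i →
      N (p ++ i :: j :: q) = N (p ++ j :: i :: q) + φ p i j q := fun p i j q hl hij =>
    Straightens.unique hc hb hl (hN _) (.swap p i j q _ hij (hN _))
  refine ⟨N, fun w hw hl => Straightens.unique hc hb hl (hN w) (.sorted w hw),
    fun p i j q hl => ?_⟩
  rcases lt_trichotomy i j with hij | rfl | hij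
  · rw [key p j i q (by simpa using hl) hij, ha p i j q]
    abel
  · rw [h0, add_zero]
  · exact key p i j q hl hij

end Straightening

/-! ### Words in the tensor algebra -/

section Words

variable {V : Type*} [AddCommGroup V] [Module ℂ V] {d : ℕ} (b : Module.Basis (Fin d) ℂ V)

/-- The tensor which is the product of the basis vectors listed in a word. -/
def word (w : List (Fin d)) : TensorAlgebra ℂ V := (w.map fun i => TensorAlgebra.ι ℂ (b i)).prod

@[simp] theorem word_nil : word b [] = 1 := rfl

theorem word_cons (i : Fin d) (w : List (Fin d)) :
    word b (i :: w) = TensorAlgebra.ι ℂ (b i) * word b w := by simp [word]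

theorem word_append (p q : List (Fin d)) : word b (p ++ q) = word b p * word b q := by
  simp [word]

/-- The words form a basis of the tensor algebra. -/
def wordBasis : Module.Basis (List (Fin d)) ℂ (TensorAlgebra ℂ V) :=
  b.tensorAlgebra.reindex FreeMonoid.toList

theorem wordBasis_apply (w : List (Fin d)) : wordBasis b w = word b w := by
  have h : FreeAlgebra.basisFreeMonoid ℂ (Fin d) (FreeMonoid.ofList w) =
      (w.map (FreeAlgebra.ι ℂ)).prod := by
    induction w with
    | nil => simp [FreeAlgebra.basisFreeMonoid, FreeAlgebra.equivMonoidAlgebraFreeMonoid]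
    | cons i w ih =>
      rw [List.map_cons, List.prod_cons, ← ih]
      simp [FreeAlgebra.basisFreeMonoid, FreeAlgebra.equivMonoidAlgebraFreeMonoid]
  simp only [wordBasis, Module.Basis.tensorAlgebra, Module.Basis.reindex_apply,
    Module.Basis.map_apply]
  erw [h]
  simp [word, map_list_prod, Function.comp_def]

theorem constr_word {M : Type*} [AddCommGroup M] [Module ℂ M] (f : List (Fin d) → M)
    (w : List (Fin d)) : (wordBasis b).constr ℂ f (word b w) = f w := by
  rw [← wordBasis_apply, Module.Basis.constr_basis]

/-- The tensors of degree `n`. -/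
abbrev tensorDegree (V : Type*) [AddCommGroup V] [Module ℂ V] (n : ℕ) :
    Submodule ℂ (TensorAlgebra ℂ V) :=
  LinearMap.range (TensorAlgebra.ι ℂ (M := V)) ^ n

theorem word_mem (w : List (Fin d)) : word b w ∈ tensorDegree V w.length := by
  induction w with
  | nil => simp [tensorDegree]
  | cons i w ih =>
    rw [word_cons, List.length_cons, tensorDegree, pow_succ']
    exact Submodule.mul_mem_mul ⟨_, rfl⟩ ih

theorem tensorDegree_eq_span (n : ℕ) :
    tensorDegree V n = Submodule.span ℂ {x | ∃ w : List (Fin d), w.length = n ∧ x = word b w} := by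
  refine le_antisymm ?_ (Submodule.span_le.mpr ?_)
  · have hr : LinearMap.range (TensorAlgebra.ι ℂ (M := V)) =
        Submodule.span ℂ (Set.range fun i => TensorAlgebra.ι ℂ (b i)) := by
      rw [LinearMap.range_eq_map, ← b.span_eq, Submodule.map_span, ← Set.range_comp]
      rfl
    induction n with
    | zero =>
      rw [tensorDegree, pow_zero, Submodule.one_le]
      exact Submodule.subset_span ⟨[], rfl, rfl⟩
    | succ n ih =>
      rw [tensorDegree, pow_succ', hr]
      rw [tensorDegree, hr] at ih
      refine le_trans (Submodule.mul_le.mpr fun x hx y hy => Submodule.mul_mem_mul hx (ih hy)) ?_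
      rw [Submodule.span_mul_span]
      refine Submodule.span_mono ?_
      rintro _ ⟨_, ⟨i, rfl⟩, _, ⟨w, rfl, rfl⟩, rfl⟩
      exact ⟨i :: w, rfl, (word_cons b i w).symm⟩
  · rintro _ ⟨w, rfl, rfl⟩
    exact word_mem b w

theorem tensorAction_mem (g : V ≃ₗ[ℂ] V) {n : ℕ} {x : TensorAlgebra ℂ V}
    (hx : x ∈ tensorDegree V n) : tensorAction g x ∈ tensorDegree V n := by
  have h := Submodule.mem_map_of_mem (f := (tensorAction g).toAlgHom.toLinearMap) hx
  rw [tensorDegree, Submodule.map_pow] at h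
  refine SetLike.le_def.mp (pow_le_pow_left' ?_ n) h
  rintro _ ⟨_, ⟨v, rfl⟩, rfl⟩
  exact ⟨g v, (tensorAction_ι g v).symm⟩

end Words

/-! ### Compatible families and normal forms of tensors -/

section Compatible

variable {V : Type*} [AddCommGroup V] [Module ℂ V] {G : Subgroup (V ≃ₗ[ℂ] V)}

/-- The scalar `α(h,g) α(hgh⁻¹,h)⁻¹` by which `h̄ ḡ h̄⁻¹` differs from the basis element of
`hgh⁻¹`. -/
def conjScalar (α : TwoCocycle G) (h g : G) : ℂ := ((α h g * (α (h * g * h⁻¹) h)⁻¹ : ℂˣ) : ℂ)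

/-- The explicit conditions on the forms `a_g` for `A` to be a twisted graded Hecke algebra. -/
structure IsCompatible (α : TwoCocycle G) (a : G → LinearMap.BilinForm ℂ V) : Prop where
  skew : ∀ g v w, a g v w = -a g w v
  equivariant : ∀ (h g : G) (v w : V), a (h * g * h⁻¹) ((h : V ≃ₗ[ℂ] V) v) ((h : V ≃ₗ[ℂ] V) w) =
    conjScalar α h g * a g v w
  jacobi : ∀ (g : G) (u v w : V), a g u v • ((g : V ≃ₗ[ℂ] V) w - w) +
    a g v w • ((g : V ≃ₗ[ℂ] V) u - u) + a g w u • ((g : V ≃ₗ[ℂ] V) v - v) = 0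

variable {M : Type*} [AddCommGroup M] [Module ℂ M] [Fintype G]

/-- The term by which the value of `N` on `p v w q` and on `p w v q` shall differ. -/
def correction (a : G → LinearMap.BilinForm ℂ V) (τ : G → M →ₗ[ℂ] M)
    (N : TensorAlgebra ℂ V →ₗ[ℂ] M) (p : TensorAlgebra ℂ V) (v w : V) (q : TensorAlgebra ℂ V) : M :=
  ∑ g : G, a g v w • τ g (N (p * tensorAction (g : V ≃ₗ[ℂ] V) q))

/-- `vw - wv`, as a tensor. -/
def bracket (v w : V) : TensorAlgebra ℂ V :=
  TensorAlgebra.ι ℂ v * TensorAlgebra.ι ℂ w - TensorAlgebra.ι ℂ w * TensorAlgebra.ι ℂ v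

variable {a : G → LinearMap.BilinForm ℂ V} {τ : G → M →ₗ[ℂ] M}
  {N : TensorAlgebra ℂ V →ₗ[ℂ] M}

theorem tensorAction_bracket (g : V ≃ₗ[ℂ] V) (v w : V) :
    tensorAction g (bracket v w) = bracket (g v) (g w) := by
  simp [bracket, tensorAction_ι]

/-- `N` respects the relations of `A`, on tensors of degree at most `n`. -/
def RespectsBracket (a : G → LinearMap.BilinForm ℂ V) (τ : G → M →ₗ[ℂ] M)
    (N : TensorAlgebra ℂ V →ₗ[ℂ] M) (n : ℕ) : Prop :=
  ∀ k l : ℕ, k + l + 2 ≤ n → ∀ p ∈ tensorDegree V k, ∀ q ∈ tensorDegree V l, ∀ v w : V,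
    N (p * bracket v w * q) = correction a τ N p v w q

theorem respectsBracket_of_words {d : ℕ} (b : Module.Basis (Fin d) ℂ V) {n : ℕ}
    (h : ∀ (p q : List (Fin d)) (i j : Fin d), p.length + q.length + 2 ≤ n →
      N (word b p * bracket (b i) (b j) * word b q) =
        correction a τ N (word b p) (b i) (b j) (word b q)) :
    RespectsBracket a τ N n := by
  intro k l hkl p hp q hq v w
  rw [tensorDegree_eq_span b] at hp hq
  induction hp using Submodule.span_induction with
  | zero => simp [correction]
  | add x y _ _ hx hy =>
    simp only [correction, add_mul, map_add, hx, hy, smul_add, Finset.sum_add_distrib]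
  | smul c x _ hx =>
    simp only [correction, smul_mul_assoc, map_smul, hx, Finset.smul_sum, smul_comm c]
  | mem p hp =>
  obtain ⟨p, rfl, rfl⟩ := hp
  induction hq using Submodule.span_induction with
  | zero => simp [correction]
  | add x y _ _ hx hy =>
    simp only [correction, mul_add, map_add, hx, hy, smul_add, Finset.sum_add_distrib]
  | smul c x _ hx =>
    simp only [correction, mul_smul_comm, map_smul, hx, Finset.smul_sum, smul_comm c]
  | mem q hq =>
  obtain ⟨q, rfl, rfl⟩ := hq
  induction b.mem_span v using Submodule.span_induction with
  | zero => simp [correction, bracket]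
  | add x y _ _ hx hy =>
    have : bracket (x + y) w = bracket x w + bracket y w := by
      simp only [bracket, map_add, add_mul, mul_add]; abel
    simp only [correction, this, mul_add, add_mul, map_add, hx, hy, LinearMap.add_apply, add_smul,
      Finset.sum_add_distrib]
  | smul c x _ hx =>
    have : bracket (c • x) w = c • bracket x w := by
      simp only [bracket, map_smul, smul_mul_assoc, mul_smul_comm, smul_sub]
    simp only [correction, this, mul_smul_comm, smul_mul_assoc, map_smul, hx, LinearMap.smul_apply,
      smul_eq_mul, mul_smul, Finset.smul_sum]
  | mem v hv =>
  obtain ⟨i, rfl⟩ := hv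
  induction b.mem_span w using Submodule.span_induction with
  | zero => simp [correction, bracket]
  | add x y _ _ hx hy =>
    have : bracket (b i) (x + y) = bracket (b i) x + bracket (b i) y := by
      simp only [bracket, map_add, add_mul, mul_add]; abel
    simp only [correction, this, mul_add, add_mul, map_add, hx, hy, add_smul,
      Finset.sum_add_distrib]
  | smul c x _ hx =>
    have : bracket (b i) (c • x) = c • bracket (b i) x := by
      simp only [bracket, map_smul, smul_mul_assoc, mul_smul_comm, smul_sub]
    simp only [correction, this, mul_smul_comm, smul_mul_assoc, map_smul, hx,
      smul_eq_mul, mul_smul, Finset.smul_sum]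
  | mem w hw =>
  obtain ⟨j, rfl⟩ := hw
  exact h p q i j hkl

/-- The commutation rule of the operators `τ g`, modelled on right multiplication by `t ḡ`. -/
def OperatorsCommute (a : G → LinearMap.BilinForm ℂ V) (τ : G → M →ₗ[ℂ] M) : Prop :=
  ∀ (g h : G) (x y : V) (m : M),
    a (g * h * g⁻¹) ((g : V ≃ₗ[ℂ] V) x) ((g : V ≃ₗ[ℂ] V) y) • τ g (τ (g * h * g⁻¹) m) =
      a h x y • τ h (τ g m)

/-- Two brackets in disjoint positions may be resolved in either order. Resolving the left one first
moves its g past the right one, turning (x, y) into (gx, gy); the double sums match after h ↦ ghg⁻¹.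
-/
theorem correction_comm (hτ : OperatorsCommute a τ) (p q r : TensorAlgebra ℂ V) (v w x y : V) :
    ∑ h : G, a h x y • τ h (correction a τ N p v w (q * tensorAction (h : V ≃ₗ[ℂ] V) r)) =
      ∑ g : G, a g v w • τ g (correction a τ N (p * tensorAction (g : V ≃ₗ[ℂ] V) q)
        ((g : V ≃ₗ[ℂ] V) x) ((g : V ≃ₗ[ℂ] V) y) (tensorAction (g : V ≃ₗ[ℂ] V) r)) := by
  simp only [correction, map_sum, map_smul, Finset.smul_sum]
  rw [Finset.sum_comm]
  refine Finset.sum_congr rfl fun g _ => ?_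
  symm
  rw [← Equiv.sum_comp (MulAut.conj g).toEquiv]
  refine Finset.sum_congr rfl fun h _ => ?_
  simp only [MulEquiv.toEquiv_eq_coe, EquivLike.coe_coe, MulAut.conj_apply]
  rw [hτ, smul_comm]
  congr 5
  rw [map_mul (tensorAction _), mul_assoc, ← AlgEquiv.mul_apply, ← AlgEquiv.mul_apply, ← map_mul, ← map_mul,
    ← Subgroup.coe_mul, ← Subgroup.coe_mul, inv_mul_cancel_right]

variable {d : ℕ} {b : Module.Basis (Fin d) ℂ V}

/-- A swap changes the other correction by a bracket inside the argument of `N`. There the degree is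
at most n, so `N` resolves it, and both orders leave a double sum handled by `correction_comm`. -/
theorem swapsCommute_correction (hτ : OperatorsCommute a τ) {n : ℕ}
    (hN : RespectsBracket a τ N n) :
    SwapsCommute (fun p i j q => correction a τ N (word b p) (b i) (b j) (word b q)) (n + 1) := by
  intro p i j q k l r hl
  have hl' : p.length + q.length + r.length + 3 = n := by
    simp only [List.length_append, List.length_cons] at hl; omega
  have h1 : correction a τ N (word b (p ++ i :: j :: q)) (b k) (b l) (word b r) =
      correction a τ N (word b (p ++ j :: i :: q)) (b k) (b l) (word b r) +
        ∑ h : G, a h (b k) (b l) • τ h (correction a τ N (word b p) (b i) (b j)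
          (word b q * tensorAction (h : V ≃ₗ[ℂ] V) (word b r))) := by
    rw [correction, correction, ← Finset.sum_add_distrib]
    refine Finset.sum_congr rfl fun h _ => ?_
    rw [← hN p.length (q.length + r.length) (by omega) _ (word_mem b p) _
      (by rw [tensorDegree, pow_add]
          exact Submodule.mul_mem_mul (word_mem b q) (tensorAction_mem _ (word_mem b r))),
      ← smul_add, ← map_add, ← map_add]
    congr 3
    simp only [word_append, word_cons, bracket]
    noncomm_ring
  have h2 : correction a τ N (word b p) (b i) (b j) (word b (q ++ k :: l :: r)) =
      correction a τ N (word b p) (b i) (b j) (word b (q ++ l :: k :: r)) +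
        ∑ g : G, a g (b i) (b j) • τ g (correction a τ N
          (word b p * tensorAction (g : V ≃ₗ[ℂ] V) (word b q)) ((g : V ≃ₗ[ℂ] V) (b k))
            ((g : V ≃ₗ[ℂ] V) (b l)) (tensorAction (g : V ≃ₗ[ℂ] V) (word b r))) := by
    rw [correction, correction, ← Finset.sum_add_distrib]
    refine Finset.sum_congr rfl fun g _ => ?_
    rw [← hN (p.length + q.length) r.length (by omega) _
      (by rw [tensorDegree, pow_add]
          exact Submodule.mul_mem_mul (word_mem b p) (tensorAction_mem _ (word_mem b q))) _
      (tensorAction_mem _ (word_mem b r)), ← smul_add, ← map_add, ← map_add,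
      ← tensorAction_bracket]
    congr 3
    simp only [word_append, word_cons, bracket, map_mul, map_sub]
    noncomm_ring
  dsimp only
  rw [h1, h2, correction_comm hτ]
  abel

/-- For each g the six terms pair up: the two involving one fixed pair of letters differ by a_g of
that pair times p(gx − x)(g·q), x the third letter. Their sum is the Jacobi condition multiplied by
p and g·q. -/
theorem swapsBraid_correction {n : ℕ} (hskew : ∀ g v w, a g v w = -a g w v)
    (hjac : ∀ (g : G) (u v w : V), a g u v • ((g : V ≃ₗ[ℂ] V) w - w) +
      a g v w • ((g : V ≃ₗ[ℂ] V) u - u) + a g w u • ((g : V ≃ₗ[ℂ] V) v - v) = 0) :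
    SwapsBraid (fun p i j q => correction a τ N (word b p) (b i) (b j) (word b q)) n := by
  intro p i j k q _
  dsimp only [correction]
  simp only [← Finset.sum_add_distrib]
  refine Finset.sum_congr rfl fun g _ => ?_
  simp only [← map_smul, ← map_add]
  congr 2
  simp only [word_append, word_cons, word_nil, mul_one, map_mul, tensorAction_ι, mul_assoc]
  have h := congrArg (fun v => word b p * (TensorAlgebra.ι ℂ v *
    tensorAction (g : V ≃ₗ[ℂ] V) (word b q))) (hjac g (b i) (b j) (b k))
  simp only [map_add, map_smul, map_sub, map_zero, zero_mul, mul_zero, add_mul, mul_add,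
    smul_mul_assoc, mul_smul_comm, sub_mul, mul_sub, smul_sub] at h
  rw [hskew g (b k) (b i)] at h
  simp only [neg_smul] at h
  rw [← sub_eq_zero, ← h]
  abel

/-- A correction for a word of length n + 1 evaluates `N` only in degree n − 1, where it is already
settled. So the swap terms are known in advance and straightening applies. -/
theorem exists_step {n : ℕ} (f : List (Fin d) → M) (hτ : OperatorsCommute a τ)
    (hskew : ∀ g v w, a g v w = -a g w v)
    (hjac : ∀ (g : G) (u v w : V), a g u v • ((g : V ≃ₗ[ℂ] V) w - w) +
      a g v w • ((g : V ≃ₗ[ℂ] V) u - u) + a g w u • ((g : V ≃ₗ[ℂ] V) v - v) = 0)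
    (hN : RespectsBracket a τ N n)
    (hf : ∀ w : List (Fin d), w.Pairwise (· ≤ ·) → w.length ≤ n → N (word b w) = f w) :
    ∃ N' : TensorAlgebra ℂ V →ₗ[ℂ] M, (RespectsBracket a τ N' (n + 1) ∧
      ∀ w : List (Fin d), w.Pairwise (· ≤ ·) → w.length ≤ n + 1 → N' (word b w) = f w) ∧
      ∀ k ≤ n, ∀ x ∈ tensorDegree V k, N' x = N x := by
  have hdiag : ∀ g v, a g v v = 0 := fun g v => by
    have := hskew g v v
    linear_combination this / 2
  obtain ⟨L, hL, hL'⟩ := exists_straightening (n + 1) f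
    (swapsCommute_correction (b := b) hτ hN) (swapsBraid_correction (N := N) hskew hjac)
    (fun p i j q => by
      simp only [correction, ← Finset.sum_neg_distrib, hskew _ (b i) (b j), neg_smul])
    (fun p i q => by simp [correction, hdiag])
  -- Only the values of `L` on words of length n + 1 matter; longer words receive arbitrary ones.
  set N' : TensorAlgebra ℂ V →ₗ[ℂ] M :=
    (wordBasis b).constr ℂ fun w => if w.length ≤ n then N (word b w) else L w with hN'
  have hw : ∀ w, N' (word b w) = if w.length ≤ n then N (word b w) else L w := fun w => by
    rw [hN', constr_word]
  have heq : ∀ k ≤ n, ∀ x ∈ tensorDegree V k, N' x = N x := by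
    intro k hk x hx
    rw [tensorDegree_eq_span b] at hx
    refine LinearMap.eqOn_span (f := N') (g := N) ?_ hx
    rintro _ ⟨w, rfl, rfl⟩
    rw [hw, if_pos hk]
  refine ⟨N', ⟨respectsBracket_of_words b fun p q i j hl => ?_, fun w hs hl => ?_⟩, heq⟩
  · have hmem : ∀ i j, (word b p * (TensorAlgebra.ι ℂ (b i) * TensorAlgebra.ι ℂ (b j)) *
        word b q) = word b (p ++ i :: j :: q) := fun i j => by
      simp only [word_append, word_cons, mul_assoc]
    have hc : correction a τ N' (word b p) (b i) (b j) (word b q) =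
        correction a τ N (word b p) (b i) (b j) (word b q) := by
      refine Finset.sum_congr rfl fun g _ => ?_
      rw [heq (p.length + q.length) (by omega)]
      rw [tensorDegree, pow_add]
      exact Submodule.mul_mem_mul (word_mem b p) (tensorAction_mem _ (word_mem b q))
    rw [hc]
    rcases Nat.lt_or_ge n (p.length + q.length + 2) with hlt | hle
    · rw [bracket, mul_sub, sub_mul, hmem, hmem, map_sub, hw, hw, if_neg (by simp; omega),
        if_neg (by simp; omega), hL' p i j q (by simp; omega)]
      abel
    · rw [← hN p.length q.length hle _ (word_mem b p) _ (word_mem b q), bracket, mul_sub, sub_mul,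
        hmem, hmem, map_sub, map_sub, hw, hw, if_pos (by simp; omega), if_pos (by simp; omega)]
  · rw [hw]
    split_ifs with h
    · exact hf w hs h
    · exact hL w hs (by omega)

/-- A linear map on tensors with prescribed values on the sorted words, which respects the
relations of `A`. -/
theorem exists_normalForm (f : List (Fin d) → M) (hτ : OperatorsCommute a τ)
    (hskew : ∀ g v w, a g v w = -a g w v)
    (hjac : ∀ (g : G) (u v w : V), a g u v • ((g : V ≃ₗ[ℂ] V) w - w) +
      a g v w • ((g : V ≃ₗ[ℂ] V) u - u) + a g w u • ((g : V ≃ₗ[ℂ] V) v - v) = 0) :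
    ∃ N : TensorAlgebra ℂ V →ₗ[ℂ] M,
      (∀ p v w q, N (p * bracket v w * q) = correction a τ N p v w q) ∧
      ∀ w : List (Fin d), w.Pairwise (· ≤ ·) → N (word b w) = f w := by
  let Q : ℕ → (TensorAlgebra ℂ V →ₗ[ℂ] M) → Prop := fun n N => RespectsBracket a τ N n ∧
    ∀ w : List (Fin d), w.Pairwise (· ≤ ·) → w.length ≤ n → N (word b w) = f w
  -- In degree 0 there is no room for a bracket, so any extension of `f` will do.
  have h0 : Q 0 ((wordBasis b).constr ℂ f) :=
    ⟨fun k l h => absurd h (by omega), fun w _ _ => constr_word b f w⟩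
  choose! S hS hS' using fun n (N : TensorAlgebra ℂ V →ₗ[ℂ] M) (h : Q n N) =>
    exists_step (b := b) f hτ hskew hjac h.1 h.2
  let F : ℕ → (TensorAlgebra ℂ V →ₗ[ℂ] M) := fun n =>
    Nat.rec ((wordBasis b).constr ℂ f) (fun n N => S n N) n
  have hF : ∀ n, Q n (F n) := fun n => by
    induction n with
    | zero => exact h0
    | succ n ih => exact hS n _ ih
  have hF' : ∀ k m, k ≤ m → ∀ x ∈ tensorDegree V k, F m x = F k x := by
    intro k m hkm x hx
    induction m, hkm using Nat.le_induction with
    | base => rfl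
    | succ m hkm ih => rw [← ih]; exact hS' m _ (hF m) k hkm x hx
  -- The successive maps are stable in each degree, so their limit is read off on the diagonal.
  set N : TensorAlgebra ℂ V →ₗ[ℂ] M :=
    (wordBasis b).constr ℂ fun w => F w.length (word b w) with hN
  have hw : ∀ w, N (word b w) = F w.length (word b w) := fun w => by
    rw [hN, constr_word]
  have heq : ∀ k m, k ≤ m → ∀ x ∈ tensorDegree V k, N x = F m x := by
    intro k m hk x hx
    rw [tensorDegree_eq_span b] at hx
    refine LinearMap.eqOn_span (f := N) (g := F m) ?_ hx
    rintro _ ⟨w, rfl, rfl⟩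
    rw [hw, hF' _ _ hk _ (word_mem b w)]
  have hresp : ∀ n, RespectsBracket a τ N n := fun n =>
    respectsBracket_of_words b fun p q i j hl => by
      have h := (hF (p.length + q.length + 2)).1 p.length q.length le_rfl _ (word_mem b p) _
        (word_mem b q) (b i) (b j)
      rw [heq (p.length + q.length + 2) _ le_rfl, h]
      · refine Finset.sum_congr rfl fun g _ => ?_
        rw [heq (p.length + q.length) (p.length + q.length + 2) (by omega)]
        rw [tensorDegree, pow_add]
        exact Submodule.mul_mem_mul (word_mem b p) (tensorAction_mem _ (word_mem b q))
      · have : bracket (b i) (b j) ∈ tensorDegree V 2 := by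
          rw [tensorDegree, pow_two]
          exact Submodule.sub_mem _ (Submodule.mul_mem_mul ⟨_, rfl⟩ ⟨_, rfl⟩)
            (Submodule.mul_mem_mul ⟨_, rfl⟩ ⟨_, rfl⟩)
        rw [show p.length + q.length + 2 = p.length + 2 + q.length by omega, tensorDegree, pow_add,
          pow_add]
        exact Submodule.mul_mem_mul (Submodule.mul_mem_mul (word_mem b p) this) (word_mem b q)
  refine ⟨N, fun p v w q => ?_, fun w hs => ?_⟩
  · induction (wordBasis b).mem_span p using Submodule.span_induction with
    | zero => simp [correction]
    | add x y _ _ hx hy =>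
      simp only [correction, add_mul, map_add, hx, hy, smul_add, Finset.sum_add_distrib]
    | smul c x _ hx =>
      simp only [correction, smul_mul_assoc, map_smul, hx, Finset.smul_sum, smul_comm c]
    | mem p hp =>
    obtain ⟨p, rfl⟩ := hp
    induction (wordBasis b).mem_span q using Submodule.span_induction with
    | zero => simp [correction]
    | add x y _ _ hx hy =>
      simp only [correction, mul_add, map_add, hx, hy, smul_add, Finset.sum_add_distrib]
    | smul c x _ hx =>
      simp only [correction, mul_smul_comm, map_smul, hx, Finset.smul_sum, smul_comm c]
    | mem q hq =>
    obtain ⟨q, rfl⟩ := hq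
    simp only [wordBasis_apply]
    exact hresp _ p.length q.length le_rfl _ (word_mem b p) _ (word_mem b q) v w
  · rw [hw]
    exact (hF w.length).2 w hs le_rfl

end Compatible

/-! ### The section through sorted words -/

section Section

variable {V : Type*} [AddCommGroup V] [Module ℂ V] {d : ℕ} (b : Module.Basis (Fin d) ℂ V)

theorem algHom_word (w : List (Fin d)) :
    SymmetricAlgebra.algHom ℂ V (word b w) =
      b.symmetricAlgebra (Multiset.toFinsupp (w : Multiset (Fin d))) := by
  rw [Module.Basis.symmetricAlgebra, Module.Basis.map_apply, MvPolynomial.coe_basisMonomials]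
  refine ((SymmetricAlgebra.equivMvPolynomial b).symm_apply_eq.mpr ?_).symm
  induction w with
  | nil => simp
  | cons i w ih =>
    rw [word_cons, map_mul, map_mul, ← ih]
    have : SymmetricAlgebra.algHom ℂ V (TensorAlgebra.ι ℂ (b i)) = SymmetricAlgebra.ι ℂ V (b i) :=
      rfl
    rw [this, SymmetricAlgebra.equivMvPolynomial_ι_apply, MvPolynomial.X,
      MvPolynomial.monomial_mul, ← Multiset.cons_coe, ← Multiset.singleton_add, map_add, one_mul,
      Multiset.toFinsupp_singleton]

/-- The linear section of `T(V) → S(V)` with values in the span of the sorted words. -/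
def sortedSection : SymmetricAlgebra ℂ V →ₗ[ℂ] TensorAlgebra ℂ V :=
  b.symmetricAlgebra.constr ℂ fun m => word b ((Finsupp.toMultiset m).sort (· ≤ ·))

theorem sortedSection_word (w : List (Fin d)) :
    sortedSection b (SymmetricAlgebra.algHom ℂ V (word b w)) =
      word b ((w : Multiset (Fin d)).sort (· ≤ ·)) := by
  rw [algHom_word, sortedSection, Module.Basis.constr_basis, Multiset.toFinsupp_toMultiset]

theorem sortedSection_sorted {w : List (Fin d)} (hw : w.Pairwise (· ≤ ·)) :
    sortedSection b (SymmetricAlgebra.algHom ℂ V (word b w)) = word b w := by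
  rw [sortedSection_word, Multiset.coe_sort, List.mergeSort_of_pairwise]
  simpa using hw

theorem isGradedSection_sortedSection : IsGradedSection (sortedSection b) where
  section' s := by
    have : (SymmetricAlgebra.algHom ℂ V).toLinearMap ∘ₗ sortedSection b = LinearMap.id := by
      refine b.symmetricAlgebra.ext fun m => ?_
      rw [LinearMap.comp_apply, sortedSection, Module.Basis.constr_basis, AlgHom.toLinearMap_apply,
        algHom_word, Multiset.sort_eq, Finsupp.toMultiset_toFinsupp, LinearMap.id_apply]
    exact LinearMap.congr_fun this s
  graded n x hx := by
    change x ∈ tensorDegree V n at hx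
    change _ ∈ tensorDegree V n
    rw [tensorDegree_eq_span b] at hx
    induction hx using Submodule.span_induction with
    | zero => simp
    | add x y _ _ hx hy => rw [map_add, map_add]; exact Submodule.add_mem _ hx hy
    | smul c x _ hx => rw [map_smul, map_smul]; exact Submodule.smul_mem _ _ hx
    | mem x hx =>
      obtain ⟨w, rfl, rfl⟩ := hx
      rw [sortedSection_word]
      simpa using word_mem b ((w : Multiset (Fin d)).sort (· ≤ ·))

end Section

/-! ### The relations in the crossed product -/

section Relations

variable {V : Type*} [AddCommGroup V] [Module ℂ V] {G : Subgroup (V ≃ₗ[ℂ] V)} (α : TwoCocycle G)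

/-- The element `P s ḡ` of `T(V) #_α G [t]`. -/
abbrev elem (P : ℂ[X]) (g : G) (s : TensorAlgebra ℂ V) : TensorCrossedPoly α :=
  P ⊗ₜ CrossedProduct.of (tensorAction.comp G.subtype) α g s

theorem elem_mul_elem (P Q : ℂ[X]) (g h : G) (r s : TensorAlgebra ℂ V) :
    elem α P g r * elem α Q h s =
      elem α (P * Q) (g * h) ((α g h : ℂ) • (r * tensorAction (g : V ≃ₗ[ℂ] V) s)) := by
  rw [elem, elem, Algebra.TensorProduct.tmul_mul_tmul, CrossedProduct.of_mul_of]
  rfl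

theorem elem_sub (P : ℂ[X]) (g : G) (r s : TensorAlgebra ℂ V) :
    elem α P g (r - s) = elem α P g r - elem α P g s := by
  rw [elem, map_sub, TensorProduct.tmul_sub]

theorem elem_add (P : ℂ[X]) (g : G) (r s : TensorAlgebra ℂ V) :
    elem α P g (r + s) = elem α P g r + elem α P g s := by
  rw [elem, map_add, TensorProduct.tmul_add]

theorem elem_smul (P : ℂ[X]) (g : G) (c : ℂ) (s : TensorAlgebra ℂ V) :
    elem α P g (c • s) = c • elem α P g s := by
  rw [elem, map_smul, TensorProduct.tmul_smul]

theorem poly_smul_elem (P Q : ℂ[X]) (g : G) (s : TensorAlgebra ℂ V) :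
    P • elem α Q g s = elem α (P * Q) g s := by
  rw [elem, TensorProduct.smul_tmul', smul_eq_mul]

theorem vec_eq (v : V) : vec α v = elem α 1 1 (TensorAlgebra.ι ℂ v) := rfl

theorem tBar_eq (g : G) : tBar α g = elem α Polynomial.X g 1 := rfl

theorem vec_mul_vec_sub (v w : V) :
    vec α v * vec α w - vec α w * vec α v = elem α 1 1 (bracket v w) := by
  simp only [vec_eq, elem_mul_elem, α.one_left, mul_one, Units.val_one, one_smul, bracket, elem_sub,
    OneMemClass.coe_one, map_one, AlgEquiv.one_apply]

theorem tensorCrossedPoly_induction {p : TensorCrossedPoly α → Prop} (x : TensorCrossedPoly α)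
    (zero : p 0) (add : ∀ x y, p x → p y → p (x + y)) (elem : ∀ P g s, p (elem α P g s)) : p x := by
  induction x using TensorProduct.induction_on with
  | zero => exact zero
  | add x y hx hy => exact add x y hx hy
  | tmul P y =>
    induction y using CrossedProduct.induction with
    | zero => rw [TensorProduct.tmul_zero]; exact zero
    | add x y hx hy => rw [TensorProduct.tmul_add]; exact add _ _ hx hy
    | single g s => exact elem P g s

variable (a : G → LinearMap.BilinForm ℂ V)

/-- The defining relation of `A`. -/
def relation [Finite G] (v w : V) : TensorCrossedPoly α :=
  (vec α v * vec α w - vec α w * vec α v) - ∑ᶠ g : G, a g v w • tBar α g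

theorem relation_mem [Finite G] (v w : V) : relation α a v w ∈ heckeIdeal α a :=
  TwoSidedIdeal.subset_span ⟨v, w, rfl⟩

theorem mk_eq_zero_iff [Finite G] {x : TensorCrossedPoly α} :
    HeckeAlgebra.mk α a x = 0 ↔ x ∈ heckeIdeal α a := by
  rw [TwoSidedIdeal.mem_iff, ← RingCon.eq]
  rfl

/-- The basic computation in the ideal, used for spanning, for independence and for necessity. -/
theorem mul_relation_mul [Fintype G] (P Q : ℂ[X]) (g h : G) (p q : TensorAlgebra ℂ V) (v w : V) :
    elem α P g p * relation α a v w * elem α Q h q =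
      elem α (P * Q) (g * h) ((α g h : ℂ) •
        (p * bracket ((g : V ≃ₗ[ℂ] V) v) ((g : V ≃ₗ[ℂ] V) w) *
          tensorAction (g : V ≃ₗ[ℂ] V) q)) -
      ∑ k : G, a k v w • elem α (P * Polynomial.X * Q) (g * k * h)
        (((α g k : ℂ) * (α (g * k) h : ℂ)) •
          (p * tensorAction ((g * k : G) : V ≃ₗ[ℂ] V) q)) := by
  rw [relation, finsum_eq_sum_of_fintype, vec_mul_vec_sub, mul_sub, sub_mul, elem_mul_elem,
    elem_mul_elem, Finset.mul_sum, Finset.sum_mul]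
  congr 1
  · simp only [mul_one, α.one_right, Units.val_one, one_smul, tensorAction_bracket]
  · refine Finset.sum_congr rfl fun k _ => ?_
    rw [mul_smul_comm, smul_mul_assoc, tBar_eq, elem_mul_elem, elem_mul_elem, map_one, mul_one,
      smul_mul_assoc, smul_smul, mul_comm (α g k : ℂ)]

end Relations

/-! ### The spanning property -/

section Surjective

variable {V : Type*} [AddCommGroup V] [Module ℂ V] {G : Subgroup (V ≃ₗ[ℂ] V)} (α : TwoCocycle G)
theorem additiveMap_tmul_single [Finite G] (a : G → LinearMap.BilinForm ℂ V)
    (σ : SymmetricAlgebra ℂ V →ₗ[ℂ] TensorAlgebra ℂ V) (P : ℂ[X])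
    (g : G) (s : SymmetricAlgebra ℂ V) :
    additiveMap α a σ (P ⊗ₜ Finsupp.single g s) = HeckeAlgebra.mk α a (elem α P g (σ s)) := by
  simp only [additiveMap, LinearMap.comp_apply, LinearMap.baseChange_tmul,
    Finsupp.mapRange.linearMap_apply, Finsupp.mapRange_single]
  rfl

variable [Fintype G] (a : G → LinearMap.BilinForm ℂ V)

/-- In `A` a commutator inside a tensor drops the degree by two, at the price of a factor t. -/
theorem mk_elem_bracket (g : G) (p q : TensorAlgebra ℂ V) (v w : V) :
    HeckeAlgebra.mk α a (elem α 1 g (p * bracket v w * q)) =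
      ∑ k : G, (Polynomial.X : ℂ[X]) • HeckeAlgebra.mk α a (elem α 1 (k * g)
        ((a k v w * (α k g : ℂ)) • (p * tensorAction (k : V ≃ₗ[ℂ] V) q))) := by
  have h := mul_relation_mul α a 1 1 1 g p q v w
  have h0 : HeckeAlgebra.mk α a (elem α 1 1 p * relation α a v w * elem α 1 g q) = 0 :=
    (mk_eq_zero_iff α a).mpr
      (TwoSidedIdeal.mul_mem_right _ _ _ (TwoSidedIdeal.mul_mem_left _ _ _ (relation_mem α a v w)))
  rw [h, map_sub, sub_eq_zero] at h0
  simp only [mul_one, one_mul, α.one_left, Units.val_one, one_smul, OneMemClass.coe_one, map_one,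
    LinearEquiv.coe_one, id_eq, AlgEquiv.one_apply] at h0
  rw [h0, map_sum]
  refine Finset.sum_congr rfl fun k _ => ?_
  rw [← map_smul, poly_smul_elem, mul_one, mul_smul, elem_smul _ _ _ (a k v w)]

variable {d : ℕ} (b : Module.Basis (Fin d) ℂ V)

/-- Induction on the degree and, within a degree, on the weight of the word: swapping a descent
lowers the weight, and the bracket it leaves has lower degree. Compatibility plays no role. -/
theorem additiveMap_surjective : Function.Surjective (additiveMap α a (sortedSection b)) := by
  set W := LinearMap.range (additiveMap α a (sortedSection b)) with hW
  have key : ∀ n, ∀ x ∈ tensorDegree V n, ∀ g : G, HeckeAlgebra.mk α a (elem α 1 g x) ∈ W := by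
    intro n
    induction n using Nat.strong_induction_on with
    | _ n ih =>
    intro x hx g
    rw [tensorDegree_eq_span b] at hx
    induction hx using Submodule.span_induction with
    | zero =>
      rw [elem, map_zero, TensorProduct.tmul_zero, map_zero]
      exact W.zero_mem
    | add x y _ _ hx hy =>
      rw [elem_add, map_add]
      exact W.add_mem hx hy
    | smul c x _ hx =>
      rw [elem_smul, ← algebraMap_smul ℂ[X] c, map_smul]
      exact W.smul_mem _ hx
    | mem x hx =>
    obtain ⟨w, hw, rfl⟩ := hx
    induction hm : wordWeight w using Nat.strong_induction_on generalizing w with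
    | _ m ihm =>
    subst hm
    rcases sorted_or_exists_descent w with hs | ⟨p, i, j, q, hij, rfl⟩
    · refine ⟨1 ⊗ₜ Finsupp.single g (SymmetricAlgebra.algHom ℂ V (word b w)), ?_⟩
      rw [additiveMap_tmul_single, sortedSection_sorted b hs]
    · have hsplit : word b (p ++ i :: j :: q) = word b (p ++ j :: i :: q) +
          word b p * bracket (b i) (b j) * word b q := by
        simp only [word_append, word_cons, bracket]
        noncomm_ring
      rw [hsplit, elem_add, map_add]
      refine W.add_mem (ihm _ (wordWeight_swap_lt hij p q) _ (by simpa using hw) rfl) ?_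
      rw [mk_elem_bracket]
      refine W.sum_mem fun k _ => W.smul_mem _ (ih (p.length + q.length)
        (by simp at hw; omega) _ (Submodule.smul_mem _ _ ?_) _)
      rw [tensorDegree, pow_add]
      exact Submodule.mul_mem_mul (word_mem b p) (tensorAction_mem _ (word_mem b q))
  intro y
  obtain ⟨x, rfl⟩ : ∃ x, HeckeAlgebra.mk α a x = y := RingCon.mk'_surjective _ y
  change _ ∈ W
  induction x using tensorCrossedPoly_induction with
  | zero => rw [map_zero]; exact W.zero_mem
  | add x y hx hy => rw [map_add]; exact W.add_mem hx hy
  | elem P g s =>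
    rw [← mul_one P, ← poly_smul_elem, map_smul]
    refine W.smul_mem _ ?_
    induction (wordBasis b).mem_span s using Submodule.span_induction with
    | zero =>
      rw [elem, map_zero, TensorProduct.tmul_zero, map_zero]
      exact W.zero_mem
    | add x y _ _ hx hy =>
      rw [elem_add, map_add]
      exact W.add_mem hx hy
    | smul c x _ hx =>
      rw [elem_smul, ← algebraMap_smul ℂ[X] c, map_smul]
      exact W.smul_mem _ hx
    | mem x hx =>
      obtain ⟨w, rfl⟩ := hx
      rw [wordBasis_apply]
      exact key _ _ (word_mem b w) g

end Surjective

/-! ### Linear independence -/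

section Injective

variable {V : Type*} [AddCommGroup V] [Module ℂ V] {G : Subgroup (V ≃ₗ[ℂ] V)} (α : TwoCocycle G)

/-- Right multiplication by `ḡ` on `S ⊗ ℂG`. -/
def rightMul (S : Type*) [AddCommGroup S] [Module ℂ S] (g : G) : (G →₀ S) →ₗ[ℂ] (G →₀ S) :=
  Finsupp.lsum ℂ fun h => (α h g : ℂ) • Finsupp.lsingle (h * g)

theorem rightMul_single {S : Type*} [AddCommGroup S] [Module ℂ S] (g h : G) (s : S) :
    rightMul α S g (Finsupp.single h s) = (α h g : ℂ) • Finsupp.single (h * g) s := by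
  simp [rightMul]

theorem rightMul_rightMul {S : Type*} [AddCommGroup S] [Module ℂ S] (g h : G) :
    rightMul α S h ∘ₗ rightMul α S g = (α g h : ℂ) • rightMul α S (g * h) := by
  refine Finsupp.lhom_ext fun k s => ?_
  have hc : (α k g : ℂ) * (α (k * g) h : ℂ) = (α g h : ℂ) * (α k (g * h) : ℂ) := by
    exact_mod_cast α.cocycle k g h
  rw [LinearMap.comp_apply, rightMul_single, map_smul, rightMul_single, LinearMap.smul_apply,
    rightMul_single, smul_smul, smul_smul, hc, mul_assoc]

/-- `S(V) ⊗ ℂG [t]`. -/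
abbrev SymmetricCrossedPoly (G : Subgroup (V ≃ₗ[ℂ] V)) : Type _ :=
  ℂ[X] ⊗[ℂ] (G →₀ SymmetricAlgebra ℂ V)

/-- Right multiplication by `ḡ` on `S(V) ⊗ ℂG [t]`. -/
def rightMulPoly (g : G) : SymmetricCrossedPoly G →ₗ[ℂ[X]] SymmetricCrossedPoly G :=
  LinearMap.baseChange ℂ[X] (rightMul α (SymmetricAlgebra ℂ V) g)

theorem rightMulPoly_rightMulPoly (g h : G) (m : SymmetricCrossedPoly G) :
    rightMulPoly α h (rightMulPoly α g m) = (α g h : ℂ) • rightMulPoly α (g * h) m := by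
  rw [rightMulPoly, rightMulPoly, ← LinearMap.comp_apply, ← LinearMap.baseChange_comp,
    rightMul_rightMul, LinearMap.baseChange_smul]
  rfl

/-- Right multiplication by `t ḡ` on `S(V) ⊗ ℂG [t]`. -/
def rightMulT (g : G) : SymmetricCrossedPoly G →ₗ[ℂ] SymmetricCrossedPoly G :=
  ((Polynomial.X : ℂ[X]) • rightMulPoly α g).restrictScalars ℂ

theorem rightMulT_apply (g : G) (m : SymmetricCrossedPoly G) :
    rightMulT α g m = (Polynomial.X : ℂ[X]) • rightMulPoly α g m := rfl

variable {α} {a : G → LinearMap.BilinForm ℂ V}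

theorem IsCompatible.equivariant' (ha : IsCompatible α a) (g h : G) (v w : V) :
    a (g * h * g⁻¹) ((g : V ≃ₗ[ℂ] V) v) ((g : V ≃ₗ[ℂ] V) w) * (α (g * h * g⁻¹) g : ℂ) =
      (α g h : ℂ) * a h v w := by
  rw [ha.equivariant, conjScalar, Units.val_mul]
  have := Units.mul_inv (α (g * h * g⁻¹) g)
  linear_combination (α g h : ℂ) * a h v w * this

/-- Both composites are multiples of right multiplication by t² times the basis element of gh, with
factors α(ghg⁻¹, g) and α(g, h). The rule is therefore the equivariance condition cleared of
inverses. -/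
theorem IsCompatible.operatorsCommute (ha : IsCompatible α a) :
    OperatorsCommute a (rightMulT α) := by
  intro g h x y m
  have hX : ∀ (c : ℂ) (m : SymmetricCrossedPoly G), (Polynomial.X : ℂ[X]) • (Polynomial.X : ℂ[X]) •
      c • m = c • (Polynomial.X : ℂ[X]) • (Polynomial.X : ℂ[X]) • m := fun c m => by
    rw [smul_comm _ c m, smul_comm _ c]
  rw [rightMulT_apply, rightMulT_apply, rightMulT_apply, rightMulT_apply, map_smul, map_smul,
    rightMulPoly_rightMulPoly, rightMulPoly_rightMulPoly, hX, hX, smul_smul, smul_smul,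
    ha.equivariant', inv_mul_cancel_right, mul_comm (α g h : ℂ), mul_smul, mul_smul]

variable [Fintype G]

/-- The normal form `N`, extended by sending P s ḡ to P N(s) ḡ, vanishes on the ideal and is a left
inverse of the section. -/
theorem additiveMap_injective (ha : IsCompatible α a) {d : ℕ} (b : Module.Basis (Fin d) ℂ V) :
    Function.Injective (additiveMap α a (sortedSection b)) := by
  obtain ⟨N, hN, hNs⟩ := exists_normalForm (b := b)
    (fun w => (1 : ℂ[X]) ⊗ₜ[ℂ] Finsupp.single (1 : G) (SymmetricAlgebra.algHom ℂ V (word b w)))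
    ha.operatorsCommute ha.skew ha.jacobi
  have hNσ : ∀ s, N (sortedSection b s) = (1 : ℂ[X]) ⊗ₜ[ℂ] Finsupp.single (1 : G) s := by
    have : N ∘ₗ sortedSection b = TensorProduct.mk ℂ ℂ[X] _ 1 ∘ₗ Finsupp.lsingle (1 : G) := by
      refine b.symmetricAlgebra.ext fun m => ?_
      rw [LinearMap.comp_apply, sortedSection, Module.Basis.constr_basis,
        hNs _ (Multiset.pairwise_sort _ _), algHom_word, Multiset.sort_eq,
        Finsupp.toMultiset_toFinsupp]
      rfl
    exact LinearMap.congr_fun this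
  let N₀ : TensorCrossed α →ₗ[ℂ] SymmetricCrossedPoly G :=
    (Finsupp.lsum ℂ fun g => (rightMulPoly α g).restrictScalars ℂ ∘ₗ N) ∘ₗ
      (CrossedProduct.ofFinsupp (tensorAction.comp G.subtype) α).symm.toLinearMap
  let Nt : TensorCrossedPoly α →ₗ[ℂ[X]] SymmetricCrossedPoly G := N₀.liftBaseChange ℂ[X]
  have hNt : ∀ P g s, Nt (elem α P g s) = P • rightMulPoly α g (N s) := by
    intro P g s
    have h0 : N₀ (CrossedProduct.of (tensorAction.comp G.subtype) α g s) =
        rightMulPoly α g (N s) :=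
      Finsupp.lsum_single ℂ (fun g => (rightMulPoly α g).restrictScalars ℂ ∘ₗ N) g s
    rw [elem, LinearMap.liftBaseChange_tmul, h0]
  -- `Nt` is not multiplicative, so arbitrary factors on both sides are carried through the
  -- induction over the ideal.
  have hkill : ∀ z ∈ heckeIdeal α a, ∀ x y, Nt (x * z * y) = 0 := by
    intro z hz
    induction hz using TwoSidedIdeal.span_induction with
    | zero => simp
    | add z z' _ _ hz hz' => intro x y; rw [mul_add, add_mul, map_add, hz, hz', add_zero]
    | neg z _ hz =>
      intro x y
      have hneg : x * -z * y = -(x * z * y) :=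
        (congrArg (· * y) (mul_neg x z)).trans (neg_mul _ _)
      exact (congrArg Nt hneg).trans (by rw [map_neg, hz, neg_zero])
    | left_absorb c z _ hz => intro x y; rw [← mul_assoc, hz]
    | right_absorb c z _ hz => intro x y; rw [← mul_assoc, mul_assoc, hz]
    | mem z hz =>
    obtain ⟨v, w, rfl⟩ := hz
    intro x y
    induction x using tensorCrossedPoly_induction with
    | zero => simp
    | add x x' hx hx' => rw [add_mul, add_mul, map_add, hx, hx', add_zero]
    | elem P g p =>
    induction y using tensorCrossedPoly_induction with
    | zero => simp
    | add x x' hx hx' => rw [mul_add, map_add, hx, hx', add_zero]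
    | elem Q h q =>
    refine (congrArg Nt (mul_relation_mul α a P Q g h p q v w)).trans ?_
    -- The bracket of gv and gw produces the elements indexed by gkg⁻¹, the relation those indexed
    -- by k; hence the reindexing by conjugation.
    rw [map_sub, map_sum, sub_eq_zero, hNt, map_smul, hN, correction,
      ← Equiv.sum_comp (MulAut.conj g).toEquiv, Finset.smul_sum, map_sum, Finset.smul_sum]
    refine Finset.sum_congr rfl fun k _ => ?_
    simp only [MulEquiv.toEquiv_eq_coe, EquivLike.coe_coe, MulAut.conj_apply]
    have hq : tensorAction ((g * k * g⁻¹ : G) : V ≃ₗ[ℂ] V) (tensorAction (g : V ≃ₗ[ℂ] V) q) =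
        tensorAction ((g * k : G) : V ≃ₗ[ℂ] V) q := by
      rw [← AlgEquiv.mul_apply, ← map_mul, ← Subgroup.coe_mul, inv_mul_cancel_right]
    have hcoef : (α g h : ℂ) * a (g * k * g⁻¹) ((g : V ≃ₗ[ℂ] V) v) ((g : V ≃ₗ[ℂ] V) w) *
        (α (g * k * g⁻¹) (g * h) : ℂ) = a k v w * ((α g k : ℂ) * (α (g * k) h : ℂ)) := by
      have hc : (α (g * k * g⁻¹) g : ℂ) * (α (g * k) h : ℂ) =
          (α g h : ℂ) * (α (g * k * g⁻¹) (g * h) : ℂ) := by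
        have := α.cocycle (g * k * g⁻¹) g h
        rw [inv_mul_cancel_right] at this
        exact_mod_cast this
      linear_combination (-a (g * k * g⁻¹) ((g : V ≃ₗ[ℂ] V) v) ((g : V ≃ₗ[ℂ] V) w)) * hc +
        (α (g * k) h : ℂ) * ha.equivariant' g k v w
    have hgr : g * k * g⁻¹ * (g * h) = g * k * h := by group
    rw [hq, rightMulT_apply, LinearMap.map_smul_of_tower Nt, hNt]
    simp only [map_smul N, LinearMap.map_smul_of_tower (rightMulPoly α _) (_ : ℂ)]
    rw [map_smul (rightMulPoly α (g * h)), rightMulPoly_rightMulPoly, hgr]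
    rw [smul_comm _ (α (g * k * g⁻¹) (g * h) : ℂ), smul_smul _ (α (g * k * g⁻¹) (g * h) : ℂ),
      smul_smul, ← mul_assoc, hcoef]
    module
  refine (injective_iff_map_eq_zero _).mpr fun z hz => ?_
  have h1 : Nt (LinearMap.baseChange ℂ[X]
      ((CrossedProduct.ofFinsupp (tensorAction.comp G.subtype) α).toLinearMap ∘ₗ
        Finsupp.mapRange.linearMap (sortedSection b)) z) = 0 := by
    have := hkill _ ((mk_eq_zero_iff α a).mp hz) 1 1
    rwa [one_mul, mul_one] at this
  rw [← h1]
  clear hz h1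
  induction z using TensorProduct.induction_on with
  | zero => simp
  | add x y hx hy => rw [map_add, map_add, ← hx, ← hy]
  | tmul P x =>
    induction x using Finsupp.induction_linear with
    | zero => simp
    | add x y hx hy => rw [TensorProduct.tmul_add, map_add, map_add, ← hx, ← hy]
    | single g s =>
      have h2 : LinearMap.baseChange ℂ[X]
        ((CrossedProduct.ofFinsupp (tensorAction.comp G.subtype) α).toLinearMap ∘ₗ
          Finsupp.mapRange.linearMap (sortedSection b)) (P ⊗ₜ Finsupp.single g s) =
          elem α P g (sortedSection b s) := by
        simp only [LinearMap.comp_apply, LinearMap.baseChange_tmul,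
          Finsupp.mapRange.linearMap_apply, Finsupp.mapRange_single]
        rfl
      rw [h2, hNt, hNσ, rightMulPoly, LinearMap.baseChange_tmul, rightMul_single, α.one_left,
        one_mul, Units.val_one, one_smul, TensorProduct.smul_tmul', smul_eq_mul, mul_one]

theorem IsCompatible.isTwistedGradedHecke [FiniteDimensional ℂ V] (ha : IsCompatible α a) :
    IsTwistedGradedHecke α a :=
  ⟨ha.skew, sortedSection (Module.finBasis ℂ V), isGradedSection_sortedSection _,
    additiveMap_injective ha _, additiveMap_surjective α a _⟩

end Injective

/-! ### Necessity of the compatibility conditions -/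

section Necessity

variable {V : Type*} [AddCommGroup V] [Module ℂ V]

/-- Every functional f on V extends to an algebra map S(V) → ℂ[X], v ↦ f(v)X, and functionals
separate points. -/
theorem symmetricAlgebra_ι_injective : Function.Injective (SymmetricAlgebra.ι ℂ V) := by
  refine (injective_iff_map_eq_zero _).mpr fun v hv => ?_
  refine (Module.forall_dual_apply_eq_zero_iff ℂ v).mp fun f => ?_
  have h := congrArg (SymmetricAlgebra.lift
    (LinearMap.toSpanSingleton ℂ ℂ[X] Polynomial.X ∘ₗ f)) hv
  rw [SymmetricAlgebra.lift_ι_apply, map_zero, LinearMap.comp_apply,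
    LinearMap.toSpanSingleton_apply] at h
  exact (smul_eq_zero.mp h).resolve_right Polynomial.X_ne_zero

theorem IsGradedSection.map_one {σ : SymmetricAlgebra ℂ V →ₗ[ℂ] TensorAlgebra ℂ V}
    (hσ : IsGradedSection σ) : σ 1 = 1 := by
  have h := hσ.graded 0 1 (by simp)
  rw [_root_.map_one, pow_zero, Submodule.mem_one] at h
  obtain ⟨c, hc⟩ := h
  have h1 := hσ.section' 1
  rw [← hc, AlgHom.commutes, SymmetricAlgebra.algebraMap_eq_one_iff] at h1
  rw [← hc, h1, _root_.map_one]

theorem IsGradedSection.map_ι {σ : SymmetricAlgebra ℂ V →ₗ[ℂ] TensorAlgebra ℂ V}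
    (hσ : IsGradedSection σ) (v : V) :
    σ (SymmetricAlgebra.ι ℂ V v) = TensorAlgebra.ι ℂ v := by
  have h := hσ.graded 1 (TensorAlgebra.ι ℂ v) (by rw [pow_one]; exact ⟨v, rfl⟩)
  rw [pow_one] at h
  obtain ⟨w, hw⟩ := h
  have h1 := hσ.section' (SymmetricAlgebra.ι ℂ V v)
  change TensorAlgebra.ι ℂ w = σ (SymmetricAlgebra.ι ℂ V v) at hw
  rw [← hw] at h1 ⊢
  rw [symmetricAlgebra_ι_injective h1]

variable {G : Subgroup (V ≃ₗ[ℂ] V)} {α : TwoCocycle G} [Fintype G]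
  {a : G → LinearMap.BilinForm ℂ V} {σ : SymmetricAlgebra ℂ V →ₗ[ℂ] TensorAlgebra ℂ V}

/-- Injectivity allows coefficients of t ḡ to be compared in `A`. -/
theorem eq_zero_of_sum_mk_eq_zero (hinj : Function.Injective (additiveMap α a σ))
    (s : G → SymmetricAlgebra ℂ V)
    (h : ∑ g : G, HeckeAlgebra.mk α a (elem α Polynomial.X g (σ (s g))) = 0) (g : G) : s g = 0 := by
  simp only [← additiveMap_tmul_single] at h
  rw [← map_sum, ← TensorProduct.tmul_sum] at h
  have h1 := (injective_iff_map_eq_zero _).mp hinj _ h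
  have h2 := congrArg (TensorProduct.lid ℂ _ ∘ LinearMap.rTensor _ (Polynomial.lcoeff ℂ 1)) h1
  simp only [Function.comp_apply, LinearMap.rTensor_tmul, TensorProduct.lid_tmul, map_zero,
    Polynomial.lcoeff_apply, Polynomial.coeff_X_one, one_smul] at h2
  have h3 := DFunLike.congr_fun h2 g
  classical
  simpa [Finsupp.finsetSum_apply, Finsupp.single_apply] using h3

/-- Only degrees 0 and 1 of S(V) are involved, and there gradedness determines the section. -/
theorem IsTwistedGradedHecke.isCompatible (h : IsTwistedGradedHecke α a) : IsCompatible α a := by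
  obtain ⟨hskew, σ, hσ, hinj, -⟩ := h
  refine ⟨hskew, fun h g v w => ?_, fun g u v w => ?_⟩
  · have h1 := mk_elem_bracket α a h 1 1 ((h : V ≃ₗ[ℂ] V) v) ((h : V ≃ₗ[ℂ] V) w)
    have h2 := mul_relation_mul α a 1 1 h 1 1 1 v w
    have h0 : HeckeAlgebra.mk α a (elem α 1 h 1 * relation α a v w * elem α 1 1 1) = 0 :=
      (mk_eq_zero_iff α a).mpr (TwoSidedIdeal.mul_mem_right _ _ _
        (TwoSidedIdeal.mul_mem_left _ _ _ (relation_mem α a v w)))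
    rw [h2] at h0
    simp only [map_one, mul_one, one_mul, α.one_right, Units.val_one, one_smul] at h0 h1
    -- h̄[v, w] has been evaluated in two ways; both sums are reindexed by the group element under
    -- the bar.
    rw [map_sub, h1, sub_eq_zero, map_sum, ← Equiv.sum_comp (Equiv.mulRight h⁻¹),
      ← Equiv.sum_comp (Equiv.mulLeft h⁻¹) (fun k => HeckeAlgebra.mk α a (a k v w • _)),
      ← sub_eq_zero, ← Finset.sum_sub_distrib] at h0
    have h3 := eq_zero_of_sum_mk_eq_zero hinj
      (fun k => (a (k * h⁻¹) ((h : V ≃ₗ[ℂ] V) v) ((h : V ≃ₗ[ℂ] V) w) * (α (k * h⁻¹) h : ℂ) -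
        a (h⁻¹ * k) v w * (α h (h⁻¹ * k) : ℂ)) • 1) (by
        rw [← h0]
        refine Finset.sum_congr rfl fun k _ => ?_
        simp only [Equiv.coe_mulRight, Equiv.coe_mulLeft, inv_mul_cancel_right, mul_inv_cancel_left]
        rw [map_smul, hσ.map_one, sub_smul, mul_smul (a (h⁻¹ * k) v w), ← map_smul,
          poly_smul_elem, mul_one, ← map_sub, ← elem_smul, ← elem_sub]) (h * g)
    rw [inv_mul_cancel_left, smul_eq_zero, sub_eq_zero] at h3
    have h4 := h3.resolve_right one_ne_zero
    rw [conjScalar, Units.val_mul]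
    have := Units.mul_inv (α (h * g * h⁻¹) h)
    linear_combination (↑(α (h * g * h⁻¹) h)⁻¹ : ℂ) * h4 -
      a (h * g * h⁻¹) ((h : V ≃ₗ[ℂ] V) v) ((h : V ≃ₗ[ℂ] V) w) * this
  · have hbr : ∀ u v w : V, HeckeAlgebra.mk α a (elem α 1 1
        (TensorAlgebra.ι ℂ u * bracket v w - bracket v w * TensorAlgebra.ι ℂ u)) =
        ∑ k : G, HeckeAlgebra.mk α a (elem α Polynomial.X k
          (TensorAlgebra.ι ℂ (a k v w • (u - (k : V ≃ₗ[ℂ] V) u)))) := by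
      intro u v w
      have h1 := mk_elem_bracket α a 1 (TensorAlgebra.ι ℂ u) 1 v w
      have h2 := mk_elem_bracket α a 1 1 (TensorAlgebra.ι ℂ u) v w
      rw [mul_one] at h1
      rw [one_mul] at h2
      rw [elem_sub, map_sub, h1, h2, ← Finset.sum_sub_distrib]
      refine Finset.sum_congr rfl fun k _ => ?_
      rw [← map_smul, ← map_smul, poly_smul_elem, poly_smul_elem, ← map_sub, ← elem_sub]
      simp only [mul_one, one_mul, α.one_right, Units.val_one, map_one, tensorAction_ι, map_smul,
        map_sub, smul_sub]
    have h0 := congrArg₂ (· + ·) (congrArg₂ (· + ·) (hbr w u v) (hbr u v w)) (hbr v w u)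
    simp only [← map_add, ← elem_add, ← Finset.sum_add_distrib] at h0
    have hz : TensorAlgebra.ι ℂ w * bracket u v - bracket u v * TensorAlgebra.ι ℂ w +
        (TensorAlgebra.ι ℂ u * bracket v w - bracket v w * TensorAlgebra.ι ℂ u) +
        (TensorAlgebra.ι ℂ v * bracket w u - bracket w u * TensorAlgebra.ι ℂ v) = 0 := by
      simp only [bracket]
      noncomm_ring
    rw [hz, elem, map_zero, TensorProduct.tmul_zero, map_zero] at h0
    simp only [← hσ.map_ι] at h0
    have h1 := symmetricAlgebra_ι_injective
      ((eq_zero_of_sum_mk_eq_zero hinj _ h0.symm g).trans (map_zero _).symm)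
    rw [← neg_eq_zero, ← h1]
    simp only [smul_sub]
    abel

theorem isTwistedGradedHecke_iff [FiniteDimensional ℂ V] :
    IsTwistedGradedHecke α a ↔ IsCompatible α a :=
  ⟨IsTwistedGradedHecke.isCompatible, IsCompatible.isTwistedGradedHecke⟩

end Necessity

/-! ### The projection to `(V^g)^⊥` and its volume form -/

section Volume

variable {V : Type*} [AddCommGroup V] [Module ℂ V] {G : Subgroup (V ≃ₗ[ℂ] V)}
  (B : InvariantHermitianForm G)

theorem map_sub_self_mem_fixedPerp (g : G) (v : V) :
    (g : V ≃ₗ[ℂ] V) v - v ∈ fixedPerp B g := by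
  intro u hu
  have hu : (g : V ≃ₗ[ℂ] V) u = u := hu
  have := B.invariant g g.2 u v
  rw [hu] at this
  rw [map_sub, this, sub_self]

variable [Finite G] (g : G)

/-- The projection `V → V/V^g ≅ (V^g)^⊥`. -/
def perpProj : V →ₗ[ℂ] fixedPerp B g :=
  (Submodule.quotientEquivOfIsCompl _ _ (isCompl_fixedPerp B g)).toLinearMap ∘ₗ
    (fixedSpace (g : V ≃ₗ[ℂ] V)).mkQ

variable {g}

theorem perpProj_eq_zero_iff {v : V} :
    perpProj B g v = 0 ↔ (g : V ≃ₗ[ℂ] V) v = v := by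
  rw [perpProj, LinearMap.comp_apply, LinearEquiv.coe_coe, LinearEquiv.map_eq_zero_iff,
    Submodule.mkQ_apply, Submodule.Quotient.mk_eq_zero, mem_fixedSpace]

theorem perpProj_coe (x : fixedPerp B g) : perpProj B g x = x :=
  Submodule.quotientEquivOfIsCompl_apply_mk_right (isCompl_fixedPerp B g) x

theorem map_sub_perpProj (v : V) :
    (g : V ≃ₗ[ℂ] V) (v - perpProj B g v) = v - perpProj B g v := by
  rw [← perpProj_eq_zero_iff B, map_sub, perpProj_coe, sub_self]

theorem hPerp_apply (h : G) (x : fixedPerp B g) :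
    hPerp B g h x = perpProj B g ((h : V ≃ₗ[ℂ] V) x) := rfl

/-- An h commuting with g preserves V^g, so it descends to V/V^g. -/
theorem perpProj_map {h : G} (hg : h * g = g * h) (v : V) :
    perpProj B g ((h : V ≃ₗ[ℂ] V) v) = hPerp B g h (perpProj B g v) := by
  rw [hPerp_apply, ← sub_eq_zero, ← map_sub, ← map_sub, perpProj_eq_zero_iff,
    ← LinearEquiv.mul_apply, ← Subgroup.coe_mul, ← hg, Subgroup.coe_mul, LinearEquiv.mul_apply,
    map_sub_perpProj]

theorem finrank_fixedPerp (g : G) : Module.finrank ℂ (fixedPerp B g) =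
    Module.finrank ℂ (V ⧸ fixedSpace (g : V ≃ₗ[ℂ] V)) :=
  (Submodule.quotientEquivOfIsCompl _ _ (isCompl_fixedPerp B g)).finrank_eq.symm

variable {B} (e : Module.Basis (Fin 2) ℂ (fixedPerp B g))

/-- The volume form of `(V^g)^⊥` with respect to a basis of two elements, extended by zero to
`V`. -/
def volForm : LinearMap.BilinForm ℂ V :=
  LinearMap.mk₂ ℂ (fun v w => e.det ![perpProj B g v, perpProj B g w])
    (fun _ _ _ => by
      simp [Module.Basis.det_apply, Matrix.det_fin_two, Module.Basis.toMatrix_apply]; ring)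
    (fun _ _ _ => by
      simp [Module.Basis.det_apply, Matrix.det_fin_two, Module.Basis.toMatrix_apply]; ring)
    (fun _ _ _ => by
      simp [Module.Basis.det_apply, Matrix.det_fin_two, Module.Basis.toMatrix_apply]; ring)
    (fun _ _ _ => by
      simp [Module.Basis.det_apply, Matrix.det_fin_two, Module.Basis.toMatrix_apply]; ring)

theorem volForm_apply (v w : V) :
    volForm e v w = e.det ![perpProj B g v, perpProj B g w] := rfl

theorem volForm_apply' (v w : V) : volForm e v w =
    e.repr (perpProj B g v) 0 * e.repr (perpProj B g w) 1 -
      e.repr (perpProj B g w) 0 * e.repr (perpProj B g v) 1 := by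
  simp [volForm_apply, Module.Basis.det_apply, Matrix.det_fin_two, Module.Basis.toMatrix_apply]

theorem volForm_skew (v w : V) : volForm e v w = -volForm e w v := by
  simp only [volForm_apply']; ring

theorem volForm_basis : volForm e (e 0) (e 1) = 1 := by
  simp [volForm_apply', perpProj_coe]

theorem volForm_map {h : G} (hg : h * g = g * h) (v w : V) :
    volForm e ((h : V ≃ₗ[ℂ] V) v) ((h : V ≃ₗ[ℂ] V) w) =
      LinearMap.det (hPerp B g h) * volForm e v w := by
  rw [volForm_apply, volForm_apply, ← Module.Basis.det_comp, perpProj_map B hg, perpProj_map B hg]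
  congr 1
  ext i
  fin_cases i <;> rfl

/-- Since g − 1 factors through the projection to (V^g)^⊥, this is the image of Cramer's relation
among three vectors of a plane. -/
theorem volForm_jacobi (u v w : V) : volForm e u v • ((g : V ≃ₗ[ℂ] V) w - w) +
    volForm e v w • ((g : V ≃ₗ[ℂ] V) u - u) + volForm e w u • ((g : V ≃ₗ[ℂ] V) v - v) = 0 := by
  have hd : ∀ v : V, (g : V ≃ₗ[ℂ] V) v - v =
      ((g : V ≃ₗ[ℂ] V).toLinearMap - LinearMap.id : V →ₗ[ℂ] V) (perpProj B g v) := fun v => by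
    have := map_sub_perpProj B (g := g) v
    rw [map_sub] at this
    rw [LinearMap.sub_apply, LinearMap.id_apply, LinearEquiv.coe_coe, sub_eq_sub_iff_sub_eq_sub]
    exact this
  have h0 : volForm e u v • perpProj B g w + volForm e v w • perpProj B g u +
      volForm e w u • perpProj B g v = 0 := by
    refine e.repr.injective (Finsupp.ext fun i => ?_)
    simp only [volForm_apply', map_add, map_smul, Finsupp.add_apply, Finsupp.smul_apply,
      smul_eq_mul, map_zero, Finsupp.zero_apply]
    fin_cases i
    · simp only [Fin.zero_eta]; ring
    · simp only [Fin.mk_one]; ring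
  rw [hd u, hd v, hd w, ← map_smul, ← map_smul, ← map_smul, ← map_add, ← map_add]
  have h1 := congrArg Subtype.val h0
  simp only [Submodule.coe_add, Submodule.coe_smul, Submodule.coe_zero] at h1
  rw [h1, map_zero]

theorem eq_smul_volForm {c : LinearMap.BilinForm ℂ V} (hskew : ∀ v w, c v w = -c w v)
    (hker : ∀ v w, (g : V ≃ₗ[ℂ] V) w = w → c v w = 0) : c = c (e 0) (e 1) • volForm e := by
  have hdiag : ∀ v, c v v = 0 := fun v => by
    have := hskew v v
    linear_combination this / 2
  have hproj : ∀ v w, c v w = c (perpProj B g v) (perpProj B g w) := by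
    intro v w
    have h1 := hker v _ (map_sub_perpProj B w)
    have h2 := hker (perpProj B g w : V) _ (map_sub_perpProj B v)
    rw [map_sub, sub_eq_zero] at h1 h2
    rw [h1, hskew, h2, ← hskew]
  ext v w
  rw [hproj, LinearMap.smul_apply, LinearMap.smul_apply, volForm_apply', smul_eq_mul]
  have hx : ∀ x : fixedPerp B g, (x : V) = e.repr x 0 • (e 0 : V) + e.repr x 1 • (e 1 : V) :=
    fun x => by
      conv_lhs => rw [← e.sum_repr x]
      rw [Fin.sum_univ_two]
      rfl
  rw [hx (perpProj B g v), hx (perpProj B g w)]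
  simp only [map_add, map_smul, LinearMap.add_apply, LinearMap.smul_apply, smul_eq_mul, hdiag,
    hskew (e 1) (e 0)]
  ring

end Volume

/-! ### The scalars of conjugation -/

section Scalars

variable {V : Type*} [AddCommGroup V] [Module ℂ V] {G : Subgroup (V ≃ₗ[ℂ] V)}
  {α : TwoCocycle G}

theorem conjScalar_ne_zero (h g : G) : conjScalar α h g ≠ 0 := Units.ne_zero _

theorem conjScalar_one (h : G) : conjScalar α h 1 = 1 := by
  simp [conjScalar, α.one_left, α.one_right]

theorem conjScalar_of_commute {h g : G} (hg : h * g = g * h) :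
    conjScalar α h g = ((α h g * (α g h)⁻¹ : ℂˣ) : ℂ) := by
  rw [conjScalar, hg, mul_inv_cancel_right]

/-- Conjugation by the basis element of kh agrees with conjugation by h̄ and then by k̄, the scalar
α(k, h) cancelling. -/
theorem conjScalar_mul (k h g : G) :
    conjScalar α (k * h) g = conjScalar α k (h * g * h⁻¹) * conjScalar α h g := by
  rw [conjScalar, conjScalar, conjScalar, ← Units.val_mul]
  congr 1
  have hconj : k * h * g * (k * h)⁻¹ = k * (h * g * h⁻¹) * k⁻¹ := by group
  rw [hconj]
  set g' := h * g * h⁻¹ with hg'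
  set g'' := k * g' * k⁻¹ with hg''
  have h1 := α.cocycle k h g
  have h2 := α.cocycle k g' h
  have h3 := α.cocycle g'' k h
  rw [show g' * h = h * g by rw [hg', inv_mul_cancel_right]] at h2
  rw [show g'' * k = k * g' by rw [hg'', inv_mul_cancel_right]] at h3
  rw [mul_mul_mul_comm, ← mul_inv, ← div_eq_mul_inv, ← div_eq_mul_inv, div_eq_div_iff_mul_eq_mul]
  -- This factor completes the products that occur in the three cocycle identities.
  refine mul_left_cancel (a := α k h * α (k * g') h) ?_
  calc α k h * α (k * g') h * (α (k * h) g * (α g'' k * α g' h))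
      = (α k h * α (k * h) g) * (α g'' k * α (k * g') h) * α g' h := by ac_rfl
    _ = α h g * (α k h * α g'' (k * h)) * (α g' h * α k (h * g)) := by rw [h1, h3]; ac_rfl
    _ = α k h * α (k * g') h * (α k g' * α h g * α g'' (k * h)) := by rw [← h2]; ac_rfl

theorem IsCompatible.map_of_commute {a : G → LinearMap.BilinForm ℂ V} (ha : IsCompatible α a)
    {g h : G} (hg : h * g = g * h) (v w : V) : a g ((h : V ≃ₗ[ℂ] V) v) ((h : V ≃ₗ[ℂ] V) w) =
      ((α h g * (α g h)⁻¹ : ℂˣ) : ℂ) * a g v w := by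
  have := ha.equivariant h g v w
  rwa [conjScalar_of_commute hg, hg, mul_inv_cancel_right] at this

end Scalars

/-! ### The support of a compatible family -/

section Support

variable {V : Type*} [AddCommGroup V] [Module ℂ V] [FiniteDimensional ℂ V]
  {G : Subgroup (V ≃ₗ[ℂ] V)} {g : G} {c : LinearMap.BilinForm ℂ V}

theorem exists_map_sub_notMem (S : Submodule ℂ V)
    (hS : Module.finrank ℂ S < Module.finrank ℂ (V ⧸ fixedSpace (g : V ≃ₗ[ℂ] V))) :
    ∃ u, (g : V ≃ₗ[ℂ] V) u - u ∉ S := by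
  by_contra! h
  set δ : V →ₗ[ℂ] V := (g : V ≃ₗ[ℂ] V).toLinearMap - LinearMap.id with hδ
  have hker : LinearMap.ker δ = fixedSpace (g : V ≃ₗ[ℂ] V) := by
    ext v
    rw [LinearMap.mem_ker, mem_fixedSpace, hδ, LinearMap.sub_apply, sub_eq_zero]
    rfl
  have hle : LinearMap.range δ ≤ S := by
    rintro _ ⟨u, rfl⟩
    exact h u
  rw [← hker, δ.quotKerEquivRange.finrank_eq] at hS
  exact hS.not_ge (Submodule.finrank_mono hle)

/-- For fixed w the Jacobi condition makes c(v, w)(gu − u) a multiple of gv − v. As g − 1 has rank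
at least 2, some u has gu − u off that line. -/
theorem apply_eq_zero_of_fixed (hjac : ∀ u v w : V, c u v • ((g : V ≃ₗ[ℂ] V) w - w) +
      c v w • ((g : V ≃ₗ[ℂ] V) u - u) + c w u • ((g : V ≃ₗ[ℂ] V) v - v) = 0)
    (hg : 2 ≤ Module.finrank ℂ (V ⧸ fixedSpace (g : V ≃ₗ[ℂ] V))) (v : V) {w : V}
    (hw : (g : V ≃ₗ[ℂ] V) w = w) : c v w = 0 := by
  obtain ⟨u, hu⟩ := exists_map_sub_notMem (g := g) (Submodule.span ℂ {(g : V ≃ₗ[ℂ] V) v - v})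
    ((finrank_span_le_card _).trans_lt (by simpa using Nat.lt_of_succ_le hg))
  by_contra h
  refine hu ((Submodule.smul_mem_iff _ h).mp ?_)
  have h1 := hjac u v w
  rw [hw, sub_self, smul_zero, zero_add] at h1
  rw [eq_neg_of_add_eq_zero_left h1]
  exact Submodule.neg_mem _ (Submodule.smul_mem _ _ (Submodule.mem_span_singleton_self _))

/-- Choose u with gu − u outside the span of gv − v and gw − w; its coefficient c(v, w) must vanish.
-/
theorem eq_zero_of_two_lt (hjac : ∀ u v w : V, c u v • ((g : V ≃ₗ[ℂ] V) w - w) +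
      c v w • ((g : V ≃ₗ[ℂ] V) u - u) + c w u • ((g : V ≃ₗ[ℂ] V) v - v) = 0)
    (hg : 2 < Module.finrank ℂ (V ⧸ fixedSpace (g : V ≃ₗ[ℂ] V))) : c = 0 := by
  ext v w
  classical
  obtain ⟨u, hu⟩ := exists_map_sub_notMem (g := g)
    (Submodule.span ℂ {(g : V ≃ₗ[ℂ] V) v - v, (g : V ≃ₗ[ℂ] V) w - w})
    ((finrank_span_le_card _).trans_lt (lt_of_le_of_lt (by
      rw [Set.toFinset_insert, Set.toFinset_singleton]; exact Finset.card_le_two) hg))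
  by_contra h
  refine hu ((Submodule.smul_mem_iff _ h).mp ?_)
  have h1 : c v w • ((g : V ≃ₗ[ℂ] V) u - u) =
      -(c u v • ((g : V ≃ₗ[ℂ] V) w - w) + c w u • ((g : V ≃ₗ[ℂ] V) v - v)) := by
    rw [← sub_eq_zero, ← hjac u v w]
    abel
  rw [h1]
  exact Submodule.neg_mem _ (Submodule.add_mem _
    (Submodule.smul_mem _ _ (Submodule.subset_span (by simp)))
    (Submodule.smul_mem _ _ (Submodule.subset_span (by simp))))

/-- Here V is V^g plus the line of y = gu − u. The Jacobi condition kills c on V^g × V^g, invariance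
under g kills c(y, w) for fixed w, and skewness kills c(y, y). -/
theorem eq_zero_of_eq_one [Finite G] (B : InvariantHermitianForm G)
    (hskew : ∀ v w, c v w = -c w v)
    (hjac : ∀ u v w : V, c u v • ((g : V ≃ₗ[ℂ] V) w - w) +
      c v w • ((g : V ≃ₗ[ℂ] V) u - u) + c w u • ((g : V ≃ₗ[ℂ] V) v - v) = 0)
    (hinv : ∀ v w, c ((g : V ≃ₗ[ℂ] V) v) ((g : V ≃ₗ[ℂ] V) w) = c v w)
    (hg : Module.finrank ℂ (V ⧸ fixedSpace (g : V ≃ₗ[ℂ] V)) = 1) : c = 0 := by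
  have hdiag : ∀ v, c v v = 0 := fun v => by
    have := hskew v v
    linear_combination this / 2
  obtain ⟨u, hu⟩ := exists_map_sub_notMem (g := g) ⊥ (by rw [hg, finrank_bot]; exact one_pos)
  rw [Submodule.mem_bot] at hu
  set x : fixedPerp B g := ⟨(g : V ≃ₗ[ℂ] V) u - u, map_sub_self_mem_fixedPerp B g u⟩ with hx
  have hx0 : x ≠ 0 := fun h => hu (congrArg Subtype.val h)
  have hspan := (finrank_eq_one_iff_of_nonzero' x hx0).mp ((finrank_fixedPerp B g).trans hg)
  have hdec : ∀ v : V, ∃ (f : V) (t : ℂ), (g : V ≃ₗ[ℂ] V) f = f ∧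
      v = f + t • ((g : V ≃ₗ[ℂ] V) u - u) := fun v => by
    obtain ⟨t, ht⟩ := hspan (perpProj B g v)
    refine ⟨v - perpProj B g v, t, map_sub_perpProj B v, ?_⟩
    rw [← ht, hx]
    simp
  have hff : ∀ v w : V, (g : V ≃ₗ[ℂ] V) v = v → (g : V ≃ₗ[ℂ] V) w = w → c v w = 0 := by
    intro v w hv hw
    have h1 := hjac u v w
    rw [hv, hw, sub_self, sub_self, smul_zero, smul_zero, zero_add, add_zero] at h1
    exact (smul_eq_zero.mp h1).resolve_right hu
  have hxf : ∀ w : V, (g : V ≃ₗ[ℂ] V) w = w → c ((g : V ≃ₗ[ℂ] V) u - u) w = 0 := by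
    intro w hw
    have h1 := hinv u w
    rw [hw] at h1
    rw [map_sub, LinearMap.sub_apply, h1, sub_self]
  ext v w
  obtain ⟨f, t, hf, rfl⟩ := hdec v
  obtain ⟨f', t', hf', rfl⟩ := hdec w
  set y := (g : V ≃ₗ[ℂ] V) u - u
  simp only [map_add, map_smul, LinearMap.add_apply, LinearMap.smul_apply, smul_eq_mul,
    hff f f' hf hf', hxf f' hf', hskew f y, hxf f hf, hdiag, LinearMap.zero_apply]
  ring

theorem eq_one_of_finrank_eq_zero
    (hg : Module.finrank ℂ (V ⧸ fixedSpace (g : V ≃ₗ[ℂ] V)) = 0) : g = 1 := by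
  rw [Module.finrank_zero_iff, Submodule.Quotient.subsingleton_iff] at hg
  refine Subtype.ext (LinearEquiv.ext fun v => ?_)
  have : v ∈ fixedSpace (g : V ≃ₗ[ℂ] V) := hg ▸ Submodule.mem_top
  exact this

variable {α : TwoCocycle G}

theorem IsCompatible.isAdmissible [Finite G] (B : InvariantHermitianForm G)
    {a : G → LinearMap.BilinForm ℂ V} (ha : IsCompatible α a) {g : G} (hg : g ≠ 1)
    (hag : a g ≠ 0) : IsAdmissible B α g := by
  have h2 : Module.finrank ℂ (V ⧸ fixedSpace (g : V ≃ₗ[ℂ] V)) = 2 := by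
    have h0 : Module.finrank ℂ (V ⧸ fixedSpace (g : V ≃ₗ[ℂ] V)) ≠ 0 := fun h =>
      hg (eq_one_of_finrank_eq_zero h)
    have h1 : Module.finrank ℂ (V ⧸ fixedSpace (g : V ≃ₗ[ℂ] V)) ≠ 1 := fun h =>
      hag (eq_zero_of_eq_one B (ha.skew g) (ha.jacobi g) (fun v w => by
        rw [ha.map_of_commute rfl, mul_inv_cancel, Units.val_one, one_mul]) h)
    have h3 : ¬ 2 < Module.finrank ℂ (V ⧸ fixedSpace (g : V ≃ₗ[ℂ] V)) := fun h =>
      hag (eq_zero_of_two_lt (ha.jacobi g) h)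
    omega
  refine ⟨h2, fun h hcomm => ?_⟩
  have e : Module.Basis (Fin 2) ℂ (fixedPerp B g) :=
    Module.finBasisOfFinrankEq ℂ _ ((finrank_fixedPerp B g).trans h2)
  have heq := eq_smul_volForm e (ha.skew g) fun v _ hw =>
    apply_eq_zero_of_fixed (ha.jacobi g) h2.ge v hw
  have hc : a g (e 0) (e 1) ≠ 0 := fun h0 => hag (by rw [heq, h0, zero_smul])
  have h3 := ha.map_of_commute hcomm (e 0 : V) (e 1 : V)
  have h4 := volForm_map e hcomm (e 0 : V) (e 1 : V)
  rw [volForm_basis, mul_one] at h4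
  rw [heq] at h3
  simp only [LinearMap.smul_apply, smul_eq_mul, volForm_basis, mul_one] at h3
  rw [h4, mul_comm] at h3
  exact mul_right_cancel₀ hc h3

end Support

/-! ### Invariant skew-symmetric forms -/

section InvariantForms

theorem update_pair_zero {V : Type*} (v w x : V) : Function.update ![v, w] 0 x = ![x, w] := by
  ext i; fin_cases i <;> rfl

theorem update_pair_one {V : Type*} (v w x : V) : Function.update ![v, w] 1 x = ![v, x] := by
  ext i; fin_cases i <;> rfl

variable {V : Type*} [AddCommGroup V] [Module ℂ V]

/-- The `G`-invariant skew-symmetric bilinear forms. -/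
def invariantForms (G : Subgroup (V ≃ₗ[ℂ] V)) : Submodule ℂ (LinearMap.BilinForm ℂ V) where
  carrier := {c | (∀ v w, c v w = -c w v) ∧ ∀ g ∈ G, ∀ v w, c (g v) (g w) = c v w}
  zero_mem' := by simp
  add_mem' := by
    rintro c c' ⟨h1, h2⟩ ⟨h1', h2'⟩
    refine ⟨fun v w => ?_, fun g hg v w => ?_⟩
    · rw [LinearMap.add_apply, LinearMap.add_apply, h1, h1', LinearMap.add_apply,
        LinearMap.add_apply, neg_add]
    · simp only [LinearMap.add_apply, h2 g hg, h2' g hg]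
  smul_mem' := by
    rintro t c ⟨h1, h2⟩
    refine ⟨fun v w => ?_, fun g hg v w => ?_⟩
    · rw [LinearMap.smul_apply, LinearMap.smul_apply, h1, LinearMap.smul_apply,
        LinearMap.smul_apply, smul_neg]
    · simp only [LinearMap.smul_apply, h2 g hg]

/-- The bilinear form corresponding to a linear functional on `⋀² V`. -/
def formOfDual : Module.Dual ℂ (⋀[ℂ]^2 V) →ₗ[ℂ] LinearMap.BilinForm ℂ V where
  toFun f := LinearMap.mk₂ ℂ (fun v w => f (exteriorPower.ιMulti ℂ 2 ![v, w]))
    (fun v v' w => by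
      have := (exteriorPower.ιMulti ℂ 2).map_update_add ![v, w] 0 v v'
      rw [update_pair_zero, update_pair_zero, update_pair_zero] at this
      rw [this, map_add])
    (fun c v w => by
      have := (exteriorPower.ιMulti ℂ 2).map_update_smul ![v, w] 0 c v
      rw [update_pair_zero, update_pair_zero] at this
      rw [this, map_smul])
    (fun v w w' => by
      have := (exteriorPower.ιMulti ℂ 2).map_update_add ![v, w] 1 w w'
      rw [update_pair_one, update_pair_one, update_pair_one] at this
      rw [this, map_add])
    (fun c v w => by
      have := (exteriorPower.ιMulti ℂ 2).map_update_smul ![v, w] 1 c w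
      rw [update_pair_one, update_pair_one] at this
      rw [this, map_smul])
  map_add' _ _ := LinearMap.ext₂ fun _ _ => rfl
  map_smul' _ _ := LinearMap.ext₂ fun _ _ => rfl

theorem formOfDual_apply (f : Module.Dual ℂ (⋀[ℂ]^2 V)) (v w : V) :
    formOfDual f v w = f (exteriorPower.ιMulti ℂ 2 ![v, w]) := rfl

theorem exterior_hom_ext {W : Type*} [AddCommGroup W] [Module ℂ W] {f f' : ⋀[ℂ]^2 V →ₗ[ℂ] W}
    (h : ∀ v w, f (exteriorPower.ιMulti ℂ 2 ![v, w]) = f' (exteriorPower.ιMulti ℂ 2 ![v, w])) :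
    f = f' := by
  refine exteriorPower.linearMap_ext (AlternatingMap.ext fun m => ?_)
  have hm : m = ![m 0, m 1] := by ext i; fin_cases i <;> rfl
  rw [hm]
  exact h _ _

theorem formOfDual_injective : Function.Injective (formOfDual (V := V)) := fun _ _ h =>
  exterior_hom_ext fun v w => LinearMap.congr_fun₂ h v w

theorem exists_formOfDual_eq {c : LinearMap.BilinForm ℂ V} (hc : ∀ v w, c v w = -c w v) :
    ∃ f, formOfDual f = c := by
  have hdiag : ∀ v, c v v = 0 := fun v => by
    have := hc v v
    linear_combination this / 2
  let A : V [⋀^Fin 2]→ₗ[ℂ] ℂ :=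
    { toFun := fun m => c (m 0) (m 1)
      map_update_add' := fun m i x y => by fin_cases i <;> simp
      map_update_smul' := fun m i t x => by fin_cases i <;> simp
      map_eq_zero_of_eq' := fun m i j hij hne => by
        have : m 0 = m 1 := by
          fin_cases i <;> fin_cases j <;> first | exact absurd rfl hne | exact hij | exact hij.symm
        rw [this, hdiag] }
  refine ⟨exteriorPower.alternatingMapLinearEquiv A, LinearMap.ext₂ fun v w => ?_⟩
  rw [formOfDual_apply, exteriorPower.alternatingMapLinearEquiv_apply_ιMulti]
  rfl

variable (G : Subgroup (V ≃ₗ[ℂ] V)) [Fintype G]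

/-- The averaging projection of `⋀² V` onto the invariants. -/
def exteriorAverage : ⋀[ℂ]^2 V →ₗ[ℂ] ⋀[ℂ]^2 V :=
  (Fintype.card G : ℂ)⁻¹ • ∑ g : G, exteriorPower.map 2 (g : V ≃ₗ[ℂ] V).toLinearMap

theorem exteriorMap_comp (g h : V ≃ₗ[ℂ] V) :
    exteriorPower.map 2 g.toLinearMap ∘ₗ exteriorPower.map 2 h.toLinearMap =
      exteriorPower.map 2 (g * h).toLinearMap := by
  rw [← exteriorPower.map_comp]
  rfl

theorem exteriorMap_comp_average (g : G) :
    exteriorPower.map 2 (g : V ≃ₗ[ℂ] V).toLinearMap ∘ₗ exteriorAverage G = exteriorAverage G := by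
  refine LinearMap.ext fun x => ?_
  rw [exteriorAverage, LinearMap.comp_apply, LinearMap.smul_apply, LinearMap.sum_apply, map_smul,
    map_sum]
  congr 1
  exact Fintype.sum_equiv (Equiv.mulLeft g) _ _ fun h =>
    LinearMap.congr_fun (exteriorMap_comp _ _) x

theorem average_comp_exteriorMap (g : G) :
    exteriorAverage G ∘ₗ exteriorPower.map 2 (g : V ≃ₗ[ℂ] V).toLinearMap = exteriorAverage G := by
  refine LinearMap.ext fun x => ?_
  rw [exteriorAverage, LinearMap.comp_apply, LinearMap.smul_apply, LinearMap.sum_apply,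
    LinearMap.smul_apply, LinearMap.sum_apply]
  congr 1
  exact Fintype.sum_equiv (Equiv.mulRight g) _ _ fun h =>
    LinearMap.congr_fun (exteriorMap_comp _ _) x

theorem natCast_card_ne_zero : (Fintype.card G : ℂ) ≠ 0 := Nat.cast_ne_zero.mpr Fintype.card_ne_zero

theorem range_exteriorAverage : LinearMap.range (exteriorAverage G) = exteriorInvariants G := by
  refine le_antisymm ?_ fun x hx => ⟨x, ?_⟩
  · rintro _ ⟨x, rfl⟩ g hg
    exact LinearMap.congr_fun (exteriorMap_comp_average G ⟨g, hg⟩) x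
  · rw [exteriorAverage, LinearMap.smul_apply, LinearMap.sum_apply,
      Finset.sum_congr rfl fun (g : G) _ => hx g g.2, Finset.sum_const, Finset.card_univ,
      ← Nat.cast_smul_eq_nsmul ℂ, smul_smul, inv_mul_cancel₀ (natCast_card_ne_zero G), one_smul]

/-- Composing a functional with the average makes it invariant, and an invariant functional equals
its own average. -/
theorem map_formOfDual_range :
    (LinearMap.range (exteriorAverage G).dualMap).map formOfDual = invariantForms G := by
  refine le_antisymm ?_ fun c hc => ?_
  · rintro _ ⟨_, ⟨f, rfl⟩, rfl⟩
    refine ⟨fun v w => ?_, fun g hg v w => ?_⟩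
    · rw [formOfDual_apply, formOfDual_apply]
      have := (((exteriorAverage G).dualMap f).compAlternatingMap
        (exteriorPower.ιMulti ℂ 2)).map_swap ![w, v] (i := 0) (j := 1) (by decide)
      have hs : ![w, v] ∘ Equiv.swap (0 : Fin 2) 1 = ![v, w] := by
        ext i; fin_cases i <;> simp
      rw [hs] at this
      exact this
    · have := LinearMap.congr_fun (average_comp_exteriorMap G ⟨g, hg⟩)
        (exteriorPower.ιMulti ℂ 2 ![v, w])
      rw [LinearMap.comp_apply, exteriorPower.map_apply_ιMulti] at this
      have hm : ((g : V ≃ₗ[ℂ] V).toLinearMap ∘ ![v, w]) = ![g v, g w] := by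
        ext i; fin_cases i <;> rfl
      simp only [hm] at this
      rw [formOfDual_apply, formOfDual_apply, LinearMap.dualMap_apply, LinearMap.dualMap_apply,
        this]
  · obtain ⟨f, rfl⟩ := exists_formOfDual_eq hc.1
    refine ⟨f, ⟨f, ?_⟩, rfl⟩
    refine exterior_hom_ext fun v w => ?_
    rw [LinearMap.dualMap_apply, exteriorAverage, LinearMap.smul_apply, LinearMap.sum_apply,
      map_smul, map_sum]
    have hg : ∀ g : G, f (exteriorPower.map 2 (g : V ≃ₗ[ℂ] V).toLinearMap
        (exteriorPower.ιMulti ℂ 2 ![v, w])) = f (exteriorPower.ιMulti ℂ 2 ![v, w]) := fun g => by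
      have hm : ((g : V ≃ₗ[ℂ] V).toLinearMap ∘ ![v, w]) =
          ![(g : V ≃ₗ[ℂ] V) v, (g : V ≃ₗ[ℂ] V) w] := by
        ext i; fin_cases i <;> rfl
      rw [exteriorPower.map_apply_ιMulti, hm]
      exact hc.2 g g.2 v w
    rw [Finset.sum_congr rfl fun g _ => hg g, Finset.sum_const, Finset.card_univ,
      ← Nat.cast_smul_eq_nsmul ℂ, smul_smul, inv_mul_cancel₀ (natCast_card_ne_zero G), one_smul]

theorem finrank_invariantForms [FiniteDimensional ℂ V] :
    Module.finrank ℂ (invariantForms G) = Module.finrank ℂ (exteriorInvariants G) := by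
  rw [← map_formOfDual_range, ← range_exteriorAverage,
    ← LinearMap.finrank_range_dualMap_eq_finrank_range (exteriorAverage G)]
  exact (Submodule.equivMapOfInjective _ formOfDual_injective _).finrank_eq.symm

end InvariantForms

/-! ### The dimension of the space of compatible families -/

section Dimension

variable {V : Type*} [AddCommGroup V] [Module ℂ V] {G : Subgroup (V ≃ₗ[ℂ] V)} (α : TwoCocycle G)

/-- The linear space of compatible families. -/
def compatibleFamilies : Submodule ℂ (G → LinearMap.BilinForm ℂ V) where
  carrier := {a | IsCompatible α a}
  zero_mem' := ⟨by simp, by simp, by simp⟩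
  add_mem' := by
    intro a a' h h'
    refine ⟨fun g v w => ?_, fun k g v w => ?_, fun g u v w => ?_⟩
    · simp only [Pi.add_apply, LinearMap.add_apply, h.skew g v w, h'.skew g v w, neg_add]
    · simp only [Pi.add_apply, LinearMap.add_apply, h.equivariant, h'.equivariant, mul_add]
    · simp only [Pi.add_apply, LinearMap.add_apply, add_smul]
      have := congrArg₂ (· + ·) (h.jacobi g u v w) (h'.jacobi g u v w)
      rw [← add_zero (0 : V), ← this]
      abel
  smul_mem' := by
    intro c a h
    refine ⟨fun g v w => ?_, fun k g v w => ?_, fun g u v w => ?_⟩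
    · simp only [Pi.smul_apply, LinearMap.smul_apply, h.skew g v w, smul_neg]
    · simp only [Pi.smul_apply, LinearMap.smul_apply, h.equivariant, smul_eq_mul, mul_left_comm]
    · simp only [Pi.smul_apply, LinearMap.smul_apply, smul_assoc, ← smul_add, h.jacobi, smul_zero]

theorem isCompatible_single [DecidableEq G] {c : LinearMap.BilinForm ℂ V}
    (hc : c ∈ invariantForms G) : IsCompatible α (Pi.single (1 : G) c) where
  skew g v w := by
    rcases eq_or_ne g 1 with rfl | hg
    · simpa using hc.1 v w
    · simp [Pi.single_eq_of_ne hg]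
  equivariant h g v w := by
    rcases eq_or_ne g 1 with rfl | hg
    · simpa [conjScalar_one] using hc.2 h h.2 v w
    · have : h * g * h⁻¹ ≠ 1 := by rwa [Ne, conj_eq_one_iff]
      simp [Pi.single_eq_of_ne hg, Pi.single_eq_of_ne this]
  jacobi g u v w := by
    rcases eq_or_ne g 1 with rfl | hg
    · simp
    · simp [Pi.single_eq_of_ne hg]

/-! ### Families supported on one conjugacy class -/

section Average

variable {α} [Fintype G] [DecidableEq G] {B : InvariantHermitianForm G} {r : G}
  (e : Module.Basis (Fin 2) ℂ (fixedPerp B r))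

/-- The sum of the translates of the volume form of `(V^r)^⊥`, as a family supported on the
conjugacy class of `r`. -/
def volFamily (α : TwoCocycle G) (g : G) : LinearMap.BilinForm ℂ V :=
  ∑ h : G, if h * r * h⁻¹ = g then conjScalar α h r • (volForm e).compl₁₂
    ((h⁻¹ : G) : V ≃ₗ[ℂ] V).toLinearMap ((h⁻¹ : G) : V ≃ₗ[ℂ] V).toLinearMap else 0

theorem volFamily_apply (g : G) (v w : V) : volFamily e α g v w =
    ∑ h : G, if h * r * h⁻¹ = g then conjScalar α h r *
      volForm e (((h⁻¹ : G) : V ≃ₗ[ℂ] V) v) (((h⁻¹ : G) : V ≃ₗ[ℂ] V) w) else 0 := by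
  rw [volFamily, LinearMap.sum_apply, LinearMap.sum_apply]
  refine Finset.sum_congr rfl fun h _ => ?_
  split_ifs <;> simp

/-- Equivariance is the reindexing h ↦ kh together with `conjScalar_mul`. The Jacobi condition holds
for each translate separately. Admissibility is needed only for the family to be nonzero. -/
theorem isCompatible_volFamily : IsCompatible α (volFamily e α) where
  skew g v w := by
    rw [volFamily_apply, volFamily_apply, ← Finset.sum_neg_distrib]
    refine Finset.sum_congr rfl fun h _ => ?_
    split_ifs
    · rw [volForm_skew, mul_neg]
    · rw [neg_zero]
  equivariant k g v w := by
    rw [volFamily_apply, volFamily_apply, Finset.mul_sum, ← Equiv.sum_comp (Equiv.mulLeft k)]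
    refine Finset.sum_congr rfl fun h _ => ?_
    have hconj : k * h * r * (k * h)⁻¹ = k * g * k⁻¹ ↔ h * r * h⁻¹ = g := by
      rw [show k * h * r * (k * h)⁻¹ = k * (h * r * h⁻¹) * k⁻¹ by group, mul_left_inj,
        mul_right_inj]
    have hact : ∀ x : V, (((k * h)⁻¹ : G) : V ≃ₗ[ℂ] V) ((k : V ≃ₗ[ℂ] V) x) =
        ((h⁻¹ : G) : V ≃ₗ[ℂ] V) x := fun x => by
      rw [← LinearEquiv.mul_apply, ← Subgroup.coe_mul, mul_inv_rev, inv_mul_cancel_right]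
    simp only [Equiv.coe_mulLeft, hconj, hact, conjScalar_mul]
    split_ifs with hg
    · rw [hg, mul_assoc]
    · rw [mul_zero]
  jacobi g u v w := by
    simp only [volFamily_apply, Finset.sum_smul, ← Finset.sum_add_distrib]
    refine Finset.sum_eq_zero fun h _ => ?_
    split_ifs with hg
    · subst hg
      have hact : ∀ x : V, ((h * r * h⁻¹ : G) : V ≃ₗ[ℂ] V) x - x = (h : V ≃ₗ[ℂ] V)
          ((r : V ≃ₗ[ℂ] V) (((h⁻¹ : G) : V ≃ₗ[ℂ] V) x) - ((h⁻¹ : G) : V ≃ₗ[ℂ] V) x) := fun x => by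
        have hx : (h : V ≃ₗ[ℂ] V) (((h⁻¹ : G) : V ≃ₗ[ℂ] V) x) = x := by
          rw [← LinearEquiv.mul_apply, ← Subgroup.coe_mul, mul_inv_cancel]
          rfl
        rw [map_sub, hx]
        rfl
      rw [hact, hact, hact, mul_smul, mul_smul, mul_smul, ← smul_add, ← smul_add, ← map_smul,
        ← map_smul, ← map_smul, ← map_add, ← map_add, volForm_jacobi, map_zero, smul_zero]
    · simp

theorem volFamily_of_not_isConj {g : G} (hg : ¬ IsConj r g) : volFamily e α g = 0 := by
  ext v w
  rw [volFamily_apply, LinearMap.zero_apply, LinearMap.zero_apply]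
  refine Finset.sum_eq_zero fun h _ => if_neg fun hh => hg (isConj_iff.mpr ⟨h, hh⟩)

/-- Admissibility turns each term with h ∈ C(r) into 1, as det(h^⊥) cancels the effect of h⁻¹; the
value is the order of the centralizer. -/
theorem volFamily_self_ne_zero (hr : IsAdmissible B α r) :
    volFamily e α r (e 0) (e 1) ≠ 0 := by
  have h1 : ∀ h : G, (if h * r * h⁻¹ = r then conjScalar α h r * volForm e
      (((h⁻¹ : G) : V ≃ₗ[ℂ] V) (e 0)) (((h⁻¹ : G) : V ≃ₗ[ℂ] V) (e 1)) else 0) =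
      if h * r * h⁻¹ = r then (1 : ℂ) else 0 := by
    intro h
    split_ifs with hh
    · have hcomm : h * r = r * h := mul_inv_eq_iff_eq_mul.mp hh
      rw [conjScalar_of_commute hcomm, ← hr.2 h hcomm, ← volForm_map e hcomm,
        ← LinearEquiv.mul_apply, ← LinearEquiv.mul_apply, ← Subgroup.coe_mul, mul_inv_cancel]
      exact volForm_basis e
    · rfl
  rw [volFamily_apply, Finset.sum_congr rfl fun h _ => h1 h, Finset.sum_boole, Nat.cast_ne_zero]
  exact Finset.card_ne_zero_of_mem (a := (1 : G)) (by simp)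

end Average

variable (B : InvariantHermitianForm G)

/-- The conjugacy classes counted by `numAdmissible`. -/
abbrev AdmissibleClass [Finite G] : Type _ :=
  {C : ConjClasses G // ∃ g : G, ConjClasses.mk g = C ∧ IsAdmissible B α g}

variable {α B}

/-! ### Coordinates on the space of compatible families -/

section Representatives

variable [Finite G]

/-- An admissible representative of an admissible class. -/
def AdmissibleClass.rep (C : AdmissibleClass α B) : G := C.2.choose

theorem AdmissibleClass.mk_rep (C : AdmissibleClass α B) : ConjClasses.mk C.rep = C :=
  C.2.choose_spec.1

theorem AdmissibleClass.isAdmissible_rep (C : AdmissibleClass α B) : IsAdmissible B α C.rep :=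
  C.2.choose_spec.2

theorem IsAdmissible.ne_one {g : G} (hg : IsAdmissible B α g) : g ≠ 1 := by
  rintro rfl
  have h : fixedSpace ((1 : G) : V ≃ₗ[ℂ] V) = ⊤ := by
    ext v
    simp [mem_fixedSpace]
  have h2 := hg.1
  rw [h, Module.finrank_zero_of_subsingleton] at h2
  exact absurd h2 (by norm_num)

variable [FiniteDimensional ℂ V]

/-- A basis of `(V^g)^⊥`, for the representative `g` of an admissible class. -/
def AdmissibleClass.basis (C : AdmissibleClass α B) : Module.Basis (Fin 2) ℂ (fixedPerp B C.rep) :=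
  Module.finBasisOfFinrankEq ℂ _ ((finrank_fixedPerp B _).trans C.isAdmissible_rep.1)

variable (α B)

/-- A compatible family is determined by the form `a_1` and by one value of `a_g` for each
admissible class. -/
def coordinates : compatibleFamilies α →ₗ[ℂ] invariantForms G × (AdmissibleClass α B → ℂ) where
  toFun a := (⟨a.1 1, a.2.skew 1, fun g hg v w => by
      have := a.2.equivariant ⟨g, hg⟩ 1 v w
      rwa [conjScalar_one, mul_one, mul_inv_cancel, one_mul] at this⟩,
    fun C => a.1 C.rep (C.basis 0) (C.basis 1))
  map_add' _ _ := rfl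
  map_smul' _ _ := rfl

/-- A nonzero a_g with g ≠ 1 makes the class of g admissible. At the representative the form is its
coordinate times the volume form, hence zero, and equivariance carries this to g. -/
theorem coordinates_injective : Function.Injective (coordinates α B) := by
  refine (injective_iff_map_eq_zero _).mpr fun a ha => Subtype.ext (funext fun g => ?_)
  have ha1 : a.1 1 = 0 := congrArg (fun x => (x.1 : LinearMap.BilinForm ℂ V)) ha
  have ha2 : ∀ C : AdmissibleClass α B, a.1 C.rep (C.basis 0) (C.basis 1) = 0 := fun C =>
    congrFun (congrArg Prod.snd ha) C
  by_contra hg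
  have hg1 : g ≠ 1 := by
    rintro rfl
    exact hg ha1
  let C : AdmissibleClass α B :=
    ⟨ConjClasses.mk g, g, rfl, a.2.isAdmissible B hg1 hg⟩
  have hC := eq_smul_volForm C.basis (a.2.skew C.rep) fun v _ hw =>
    apply_eq_zero_of_fixed (a.2.jacobi C.rep) C.isAdmissible_rep.1.ge v hw
  rw [ha2, zero_smul] at hC
  obtain ⟨h, hh⟩ := isConj_iff.mp (ConjClasses.mk_eq_mk_iff_isConj.mp C.mk_rep.symm)
  refine hg (LinearMap.ext₂ fun v w => ?_)
  have := a.2.equivariant h g v w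
  rw [hh, hC, LinearMap.zero_apply, LinearMap.zero_apply] at this
  exact (mul_eq_zero.mp this.symm).resolve_left (conjScalar_ne_zero h g)

theorem coordinates_surjective : Function.Surjective (coordinates α B) := by
  classical
  have := Fintype.ofFinite G
  have := Fintype.ofFinite (AdmissibleClass α B)
  rintro ⟨c, y⟩
  -- Normalized so that these families form the basis dual to the scalar coordinates.
  let F : AdmissibleClass α B → compatibleFamilies α := fun C =>
    (volFamily C.basis α C.rep (C.basis 0) (C.basis 1))⁻¹ •
      ⟨volFamily C.basis α, isCompatible_volFamily C.basis⟩
  have hF1 : ∀ C, (F C).1 1 = 0 := fun C => by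
    have h : volFamily C.basis α 1 = 0 := volFamily_of_not_isConj C.basis fun h =>
      C.isAdmissible_rep.ne_one (isConj_one_left.mp h)
    change (volFamily C.basis α C.rep (C.basis 0) (C.basis 1))⁻¹ • volFamily C.basis α 1 = 0
    rw [h, smul_zero]
  have hF2 : ∀ C D, (F C).1 D.rep (D.basis 0) (D.basis 1) = if C = D then 1 else 0 := by
    intro C D
    change (_ : ℂ)⁻¹ * volFamily C.basis α D.rep (D.basis 0) (D.basis 1) = _
    split_ifs with h
    · subst h
      exact inv_mul_cancel₀ (volFamily_self_ne_zero C.basis C.isAdmissible_rep)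
    · have h0 : volFamily C.basis α D.rep = 0 := volFamily_of_not_isConj C.basis fun hc =>
        h (Subtype.ext (by
          rw [← C.mk_rep, ← D.mk_rep]
          exact ConjClasses.mk_eq_mk_iff_isConj.mpr hc))
      rw [h0, LinearMap.zero_apply, LinearMap.zero_apply, mul_zero]
  let A : compatibleFamilies α := ⟨Pi.single 1 c.1, isCompatible_single α c.2⟩ + ∑ C, y C • F C
  have hA : ∀ g, A.1 g = (Pi.single 1 c.1 : G → LinearMap.BilinForm ℂ V) g +
      ∑ C, y C • (F C).1 g := fun g => by
    simp only [A, Submodule.coe_add, Pi.add_apply, Submodule.coe_sum, Finset.sum_apply,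
      Submodule.coe_smul, Pi.smul_apply]
  refine ⟨A, Prod.ext (Subtype.ext ?_) (funext fun D => ?_)⟩
  · change A.1 1 = c.1
    rw [hA, Pi.single_eq_same]
    simp [hF1]
  · change A.1 D.rep (D.basis 0) (D.basis 1) = y D
    rw [hA, Pi.single_eq_of_ne D.isAdmissible_rep.ne_one, zero_add]
    simp [hF2]

theorem finrank_compatibleFamilies : Module.finrank ℂ (compatibleFamilies α) =
    numAdmissible B α + Module.finrank ℂ (exteriorInvariants G) := by
  classical
  have := Fintype.ofFinite G
  have := Fintype.ofFinite (AdmissibleClass α B)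
  have := Module.Free.of_divisionRing ℂ (invariantForms G)
  rw [(LinearEquiv.ofBijective (coordinates α B)
    ⟨coordinates_injective α B, coordinates_surjective α B⟩).finrank_eq, Module.finrank_prod,
    finrank_invariantForms, Module.finrank_fintype_fun_eq_card, add_comm, numAdmissible,
    Nat.card_eq_fintype_card]

end Representatives

end Dimension

end TwistedHecke

end

theorem corollary2p3 {V : Type*} [AddCommGroup V] [Module ℂ V] [FiniteDimensional ℂ V]
    (G : Subgroup (V ≃ₗ[ℂ] V)) [Finite G] (α : TwistedHecke.TwoCocycle G)
    (B : TwistedHecke.InvariantHermitianForm G) :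
    ∃ W : Submodule ℂ (G → LinearMap.BilinForm ℂ V),
      (W : Set (G → LinearMap.BilinForm ℂ V)) =
        {a | TwistedHecke.IsTwistedGradedHecke α a} ∧
      Module.finrank ℂ W =
        TwistedHecke.numAdmissible B α +
          Module.finrank ℂ (TwistedHecke.exteriorInvariants G) := by
  have := Fintype.ofFinite G
  refine ⟨TwistedHecke.compatibleFamilies α, Set.ext fun a => ?_,
    TwistedHecke.finrank_compatibleFamilies α B⟩
  exact TwistedHecke.isTwistedGradedHecke_iff.symm
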